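/- Let $d\ge 2$ be an integer and $s_{d-1}=2\pi^{d/2}/\Gamma(d/2)$, $\widehat d=\max\{1,d-2\}$. For $t>0$ put $\Bbbk_{d-2}(t)=\ln t$ if $d=2$ and $\Bbbk_{d-2}(t)=-t^{2-d}$ if $d>2$. Let $0<\rho\le+\infty$, let $B(\rho)\subset\mathbb R^d$ be the open ball of radius $\rho$ centred at $0$ ($B(+\infty)=\mathbb R^d$), and let $U=u-v\not\equiv\pm\infty$ be a nontrivial $\delta$-subharmonic function on $B(\rho)$, i.e. $u\not\equiv-\infty$ and $v\not\equiv-\infty$ are subharmonic on $B(\rho)$. Let $\varDelta_u=\frac{1}{s_{d-1}\widehat d}\,\triangle u$ and $\varDelta_v=\frac{1}{s_{d-1}\widehat d}\,\triangle v$ (Laplacian in the sense of distributions) be their Riesz measures, $\varDelta_U=\varDelta_u-\varDelta_v$ the Riesz charge of $U$, and $\varDelta_U^-=\sup\{0,-\varDelta_U\}$ its lower variation. For $0\le r<R<\rho$ define the difference Nevanlinna characteristic $$\boldsymbol T_U(r,R)=\frac{1}{s_{d-1}R^{d-1}}\int_{|x|=R}U^+\,d\sigma+\widehat d\int_r^R\frac{\varDelta_U^-(\{|x|\le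 t\})}{t^{d-1}}\,dt\in[0,+\infty],$$ where $\sigma$ is the surface measure on the sphere $\{|x|=R\}$. A real function $f$ on an open interval $I\subset(0,+\infty)$ is called convex (concave) with respect to $\Bbbk_{d-2}$ if $f\circ\Bbbk_{d-2}^{-1}$ is convex (concave) on $\Bbbk_{d-2}(I)$. Then: 1. $\boldsymbol T_U(r,R)\ge 0$ for all $0\le r<R<\rho$, and $\boldsymbol T_U(r,R)<+\infty$ if $r>0$. 2. For every fixed $r\ge 0$ the function $R\mapsto\boldsymbol T_U(r,R)$ is increasing (non-strictly) on $(r,\rho)$; it is finite and convex with respect to $\Bbbk_{d-2}$ on $(r,\rho)$, except that for $r=0$ it may instead be identically $+\infty$. 3. For every fixed $R\in(0,\rho)$ the function $r\mapsto\boldsymbol T_U(r,R)$ is decreasing (non-strictly) on $[0,R)$ and concave with respect to $\Bbbk_{d-2}$ on $(0,R)$. -/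

import Mathlib

open scoped ENNReal

namespace DiffNevanlinna

noncomputable section

/-- Euclidean space `ℝ^d`. -/
abbrev E (d : ℕ) : Type := EuclideanSpace ℝ (Fin d)

/-- The area `s_{d-1} = 2 π^{d/2} / Γ(d/2)` of the unit sphere of `ℝ^d`. -/
def sphereArea (d : ℕ) : ℝ :=
  2 * Real.pi ^ ((d : ℝ) / 2) / Real.Gamma ((d : ℝ) / 2)

/-- The number `max {1, d - 2}`. -/
def dHat (d : ℕ) : ℝ := max 1 ((d : ℝ) - 2)

/-- The function `𝕜_{d-2}` on `(0, ∞)`: `ln t` for `d = 2` and `-1 / t^{d-2}` for `d > 2`. -/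
def kernel (d : ℕ) (t : ℝ) : ℝ :=
  if d = 2 then Real.log t else -(1 / t ^ (d - 2))

/-- The integral `∫ f⁺ - ∫ f⁻` of an extended-real function
(`EReal.toENNReal` is the positive part). -/
def extIntegral {α : Type*} [MeasurableSpace α] (μ : MeasureTheory.Measure α)
    (f : α → EReal) : EReal :=
  ((∫⁻ x, (f x).toENNReal ∂μ : ℝ≥0∞) : EReal) - ((∫⁻ x, (-f x).toENNReal ∂μ : ℝ≥0∞) : EReal)

/-- The mean of `f` over the sphere of centre `x` and radius `r`, written as an integral over
the unit sphere with its surface measure. -/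
def sphereMean {d : ℕ} (f : E d → EReal) (x : E d) (r : ℝ) : EReal :=
  (((sphereArea d)⁻¹ : ℝ) : EReal) *
    extIntegral (MeasureTheory.volume : MeasureTheory.Measure (E d)).toSphere
      (fun ω => f (x + r • (ω : E d)))

/-- Subharmonic functions, with values in `[-∞, ∞)`, on a set `Ω` (used for open sets `Ω`);
the function `≡ -∞` is allowed. Values outside `Ω` are irrelevant. -/
structure SubharmonicOn {d : ℕ} (u : E d → EReal) (Ω : Set (E d)) : Prop where
  upperSemicontinuousOn : UpperSemicontinuousOn u Ω
  lt_top : ∀ x ∈ Ω, u x < ⊤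
  le_sphereMean : ∀ x ∈ Ω, ∀ r : ℝ, 0 < r → Metric.closedBall x r ⊆ Ω → u x ≤ sphereMean u x r

/-- `μ` is a Borel measure on the open set `Ω` (extended by zero), finite on compact subsets of
`Ω`, which equals `(s_{d-1} max{1, d-2})⁻¹ Δu` in the sense of distributions on `Ω`. -/
structure IsRieszMeasure {d : ℕ} (Ω : Set (E d)) (u : E d → EReal)
    (μ : MeasureTheory.Measure (E d)) : Prop where
  compl_eq_zero : μ Ωᶜ = 0
  lt_top_of_isCompact : ∀ K : Set (E d), IsCompact K → K ⊆ Ω → μ K < ⊤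
  integral_eq : ∀ φ : E d → ℝ, ContDiff ℝ ((⊤ : ℕ∞) : WithTop ℕ∞) φ → HasCompactSupport φ →
    tsupport φ ⊆ Ω →
    ∫ x, (u x).toReal * Laplacian.laplacian φ x = sphereArea d * dHat d * ∫ x, φ x ∂μ

open Classical in
/-- The Riesz measure of `u` on the open set `Ω`, that is, the only measure that satisfies
`IsRieszMeasure Ω u` (it exists for every subharmonic `u ≢ -∞` on a domain `Ω`). -/
def rieszMeasure {d : ℕ} (Ω : Set (E d)) (u : E d → EReal) : MeasureTheory.Measure (E d) :=
  if h : ∃ μ, IsRieszMeasure Ω u μ then h.choose else 0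

/-- A nontrivial (`≢ ±∞`) `δ`-subharmonic function on `Ω`, given as the difference `pos - neg`
of two subharmonic functions `≢ -∞` on `Ω`. -/
structure DeltaSubharmonic {d : ℕ} (Ω : Set (E d)) where
  pos : E d → EReal
  neg : E d → EReal
  subharmonicOn_pos : SubharmonicOn pos Ω
  subharmonicOn_neg : SubharmonicOn neg Ω
  pos_nontrivial : ∃ x ∈ Ω, pos x ≠ ⊥
  neg_nontrivial : ∃ x ∈ Ω, neg x ≠ ⊥

namespace DeltaSubharmonic

variable {d : ℕ} {Ω : Set (E d)}

/-- The values of `U = pos - neg`. At the points where both functions are `-∞` (a polar set)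
the difference is not defined, and the value here is immaterial. -/
def val (U : DeltaSubharmonic Ω) (x : E d) : EReal := U.pos x - U.neg x

/-- The lower variation of the Riesz charge `Δ_U = Δ_pos - Δ_neg`, that is `sup {0, -Δ_U}`.
The difference of measures is Mathlib's: `ν - μ` is the least measure `τ` with `ν ≤ τ + μ`. -/
def lowerVariation (U : DeltaSubharmonic Ω) : MeasureTheory.Measure (E d) :=
  rieszMeasure Ω U.neg - rieszMeasure Ω U.pos

end DeltaSubharmonic

/-- The radial difference integrated counting function
`N_μ(r, R) = max{1, d-2} ∫_r^R μ(closed ball of radius t) / t^{d-1} dt`. -/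
def countingN {d : ℕ} (μ : MeasureTheory.Measure (E d)) (r R : ℝ) : ℝ≥0∞ :=
  ENNReal.ofReal (dHat d) *
    ∫⁻ t in Set.Ioc r R, μ (Metric.closedBall 0 t) / ENNReal.ofReal (t ^ (d - 1))

/-- The difference Nevanlinna characteristic `T_U(r, R) = C_{U⁺}(R) + N_{Δ_U⁻}(r, R)`. -/
def nevanlinnaT {d : ℕ} {Ω : Set (E d)} (U : DeltaSubharmonic Ω) (r R : ℝ) : EReal :=
  sphereMean (fun x => max 0 (U.val x)) 0 R + (countingN U.lowerVariation r R : EReal)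

/-- `f` is convex on `I` with respect to `k`: `f ∘ k⁻¹` is convex on `k(I)`. -/
def ConvexWrt (k : ℝ → ℝ) (I : Set ℝ) (f : ℝ → ℝ) : Prop :=
  ConvexOn ℝ (k '' I) (f ∘ Function.invFunOn k I)

/-- `f` is concave on `I` with respect to `k`: `f ∘ k⁻¹` is concave on `k(I)`. -/
def ConcaveWrt (k : ℝ → ℝ) (I : Set ℝ) (f : ℝ → ℝ) : Prop :=
  ConcaveOn ℝ (k '' I) (f ∘ Function.invFunOn k I)

end

end DiffNevanlinna

/-!
For smooth `f`, the flux identity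
`d/dt ∫ ω, f (t • ω) = t ^ (1 - d) * ∫ x in ball 0 t, Δ f x` turns a lower bound `Δ f ≥ -g` into the
statement that the derivative of `t ↦ ∫ ω, f (t • ω)`, corrected by the integral of `g` over the
ball, is `t ^ (1 - d)` times a nonnegative increasing function. For `U⁺` such a bound, with `g` a
multiple of `Δ_U⁻`, is Kato's inequality. As `t ^ (1 - d)` is, up to a constant, the derivative of
the kernel, `T_U(r, ·)` is increasing and convex with respect to the kernel. In general one
mollifies `pos` and `neg`, replaces the positive part by a smooth convex approximation, and passes
to the limit in the resulting inequalities between increments over adjacent intervals `[a, b]` and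
`[b, c]`. The variable `r` enters only through the counting function, which is minus the integral of
an increasing function against the derivative of the kernel.
-/

namespace DiffNevanlinna

open MeasureTheory Metric Set Filter Topology Module
open scoped Laplacian Convolution Gradient

noncomputable section

section PolarCoordinates

variable {V : Type*} [NormedAddCommGroup V] [NormedSpace ℝ V]

theorem norm_smul_unitSphere {t : ℝ} (ht : 0 ≤ t) (ω : sphere (0 : V) 1) : ‖t • (ω : V)‖ = t := by
  rw [norm_smul, norm_eq_of_mem_sphere ω, mul_one, Real.norm_of_nonneg ht]

theorem add_smul_unitSphere_mem_closedBall (x : V) {r : ℝ} (hr : 0 ≤ r) (ω : sphere (0 : V) 1) :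
    x + r • (ω : V) ∈ closedBall x r := by
  simp [norm_smul_unitSphere hr ω]

theorem smul_homeomorphUnitSphereProd (x : ({0}ᶜ : Set V)) :
    ((homeomorphUnitSphereProd V x).2 : ℝ) • ((homeomorphUnitSphereProd V x).1 : V) = x := by
  rw [← homeomorphUnitSphereProd_symm_apply_coe, Homeomorph.symm_apply_apply]

variable [MeasurableSpace V] [BorelSpace V] [FiniteDimensional ℝ V] [Nontrivial V]
  (μ : Measure V) [μ.IsAddHaarMeasure]

theorem lintegral_polar {f : V → ℝ≥0∞} (hf : Measurable f) :
    ∫⁻ x, f x ∂μ = ∫⁻ t in Ioi (0 : ℝ), ENNReal.ofReal (t ^ (finrank ℝ V - 1)) *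
      ∫⁻ ω, f (t • (ω : V)) ∂μ.toSphere := by
  have hmeas : Measurable fun p : sphere (0 : V) 1 × Ioi (0 : ℝ) => f ((p.2 : ℝ) • (p.1 : V)) := by
    fun_prop
  calc ∫⁻ x, f x ∂μ
      = ∫⁻ x : ({0}ᶜ : Set V), f x ∂(μ.comap Subtype.val) := by
        rw [lintegral_subtype_comap (measurableSet_singleton _).compl, restrict_compl_singleton]
    _ = ∫⁻ p : sphere (0 : V) 1 × Ioi (0 : ℝ), f ((p.2 : ℝ) • (p.1 : V))
          ∂μ.toSphere.prod (.volumeIoiPow (finrank ℝ V - 1)) := by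
        rw [← μ.measurePreserving_homeomorphUnitSphereProd.lintegral_comp hmeas]
        simp only [smul_homeomorphUnitSphereProd]
    _ = ∫⁻ t : Ioi (0 : ℝ), ENNReal.ofReal ((t : ℝ) ^ (finrank ℝ V - 1)) *
          ∫⁻ ω, f ((t : ℝ) • (ω : V)) ∂μ.toSphere ∂(volume.comap Subtype.val) := by
        rw [lintegral_prod_symm' _ hmeas, Measure.volumeIoiPow,
          lintegral_withDensity_eq_lintegral_mul _ (by fun_prop) hmeas.lintegral_prod_left']
        simp only [Pi.mul_apply]
    _ = _ := lintegral_subtype_comap measurableSet_Ioi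
        (f := fun t : ℝ => ENNReal.ofReal (t ^ (finrank ℝ V - 1)) *
          ∫⁻ ω, f (t • (ω : V)) ∂μ.toSphere)

theorem setLIntegral_ball_polar {f : V → ℝ≥0∞} (hf : Measurable f) (x : V) (r : ℝ) :
    ∫⁻ y in ball x r, f y ∂μ = ∫⁻ t in Ioo 0 r, ENNReal.ofReal (t ^ (finrank ℝ V - 1)) *
      ∫⁻ ω, f (x + t • (ω : V)) ∂μ.toSphere := by
  have hshift : Measurable fun y => f (x + y) := by fun_prop
  rw [← (measurePreserving_add_left μ x).setLIntegral_comp_preimage_emb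
      (measurableEmbedding_addLeft x), preimage_add_ball, sub_self,
    ← lintegral_indicator measurableSet_ball,
    lintegral_polar μ (hshift.indicator measurableSet_ball),
    ← Iio_inter_Ioi, ← setLIntegral_indicator measurableSet_Iio]
  refine setLIntegral_congr_fun measurableSet_Ioi fun t (ht : 0 < t) => ?_
  by_cases htr : t < r <;> simp [indicator, norm_smul_unitSphere ht.le, htr]

variable {F : Type*} [NormedAddCommGroup F] [NormedSpace ℝ F]

theorem integral_polar {f : V → F} (hf : Integrable f μ) :
    ∫ x, f x ∂μ = ∫ t in Ioi (0 : ℝ), t ^ (finrank ℝ V - 1) •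
      ∫ ω, f (t • (ω : V)) ∂μ.toSphere := by
  have hpres := μ.measurePreserving_homeomorphUnitSphereProd
  have hemb := (homeomorphUnitSphereProd V).measurableEmbedding
  have hprod : Integrable (fun p : sphere (0 : V) 1 × Ioi (0 : ℝ) => f ((p.2 : ℝ) • (p.1 : V)))
      (μ.toSphere.prod (.volumeIoiPow (finrank ℝ V - 1))) := by
    rw [← hpres.integrable_comp_emb hemb]
    simp only [Function.comp_def, smul_homeomorphUnitSphereProd]
    refine (integrableOn_iff_comap_subtypeVal (measurableSet_singleton (0 : V)).compl).1 ?_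
    exact hf.integrableOn
  calc ∫ x, f x ∂μ
      = ∫ x : ({0}ᶜ : Set V), f x ∂(μ.comap Subtype.val) := by
        rw [integral_subtype_comap (measurableSet_singleton _).compl, restrict_compl_singleton]
    _ = ∫ p : sphere (0 : V) 1 × Ioi (0 : ℝ), f ((p.2 : ℝ) • (p.1 : V))
          ∂μ.toSphere.prod (.volumeIoiPow (finrank ℝ V - 1)) := by
        rw [← hpres.integral_comp hemb]
        simp only [smul_homeomorphUnitSphereProd]
    _ = ∫ t : Ioi (0 : ℝ), (t : ℝ) ^ (finrank ℝ V - 1) •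
          ∫ ω, f ((t : ℝ) • (ω : V)) ∂μ.toSphere ∂(volume.comap Subtype.val) := by
        rw [integral_prod_symm _ hprod, Measure.volumeIoiPow]
        simp only [ENNReal.ofReal]
        rw [integral_withDensity_eq_integral_smul (by fun_prop)]
        refine integral_congr_ae (Eventually.of_forall fun t => ?_)
        have ht : (0 : ℝ) ≤ t := t.2.le
        simp only [NNReal.smul_def, Real.coe_toNNReal _ (pow_nonneg ht _)]
    _ = _ := integral_subtype_comap measurableSet_Ioi
        (fun t : ℝ => t ^ (finrank ℝ V - 1) • ∫ ω, f (t • (ω : V)) ∂μ.toSphere)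

theorem setIntegral_ball_polar {f : V → F} {r : ℝ} (hf : IntegrableOn f (ball 0 r) μ) (hr : 0 ≤ r) :
    ∫ x in ball 0 r, f x ∂μ = ∫ t in 0..r, t ^ (finrank ℝ V - 1) •
      ∫ ω, f (t • (ω : V)) ∂μ.toSphere := by
  rw [← integral_indicator measurableSet_ball,
    integral_polar μ (hf.integrable_indicator measurableSet_ball),
    intervalIntegral.integral_of_le hr, integral_Ioc_eq_integral_Ioo, ← Ioi_inter_Iio,
    ← setIntegral_indicator measurableSet_Iio]
  refine setIntegral_congr_fun measurableSet_Ioi fun t (ht : 0 < t) => ?_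
  by_cases htr : t < r <;> simp [indicator, norm_smul_unitSphere ht.le, htr]

end PolarCoordinates

section Laplacian

variable {V : Type*} [NormedAddCommGroup V] [InnerProductSpace ℝ V]

theorem contDiff_fderiv_apply {f : V → ℝ} (hf : ContDiff ℝ 2 f) (v : V) :
    ContDiff ℝ 1 fun y => fderiv ℝ f y v :=
  (hf.fderiv_right (m := 1) (by norm_num)).clm_apply contDiff_const

variable [FiniteDimensional ℝ V]

theorem laplacian_eq_sum_fderiv_fderiv {ι : Type*} [Fintype ι] (b : OrthonormalBasis ι ℝ V)
    {f : V → ℝ} (hf : ContDiff ℝ 2 f) (x : V) :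
    (Δ f) x = ∑ i, fderiv ℝ (fun y => fderiv ℝ f y (b i)) x (b i) := by
  have hdiff : DifferentiableAt ℝ (fderiv ℝ f) x :=
    (hf.fderiv_right (m := 1) (by norm_num)).differentiable (by norm_num) x
  rw [InnerProductSpace.laplacian_eq_iteratedFDeriv_orthonormalBasis f b]
  refine Finset.sum_congr rfl fun i _ => ?_
  rw [(hdiff.hasFDerivAt.clm_apply (hasFDerivAt_const (b i) x)).fderiv, iteratedFDeriv_two_apply]
  simp

theorem continuous_laplacian {f : V → ℝ} (hf : ContDiff ℝ 2 f) : Continuous (Δ f) := by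
  have hsum := funext (laplacian_eq_sum_fderiv_fderiv (stdOrthonormalBasis ℝ V) hf)
  rw [hsum]
  exact continuous_finsetSum _ fun i _ =>
    ((contDiff_fderiv_apply hf _).continuous_fderiv (by norm_num)).clm_apply continuous_const

theorem laplacian_comp_add_left {f : V → ℝ} (hf : ContDiff ℝ 2 f) (x y : V) :
    (Δ fun z => f (x + z)) y = (Δ f) (x + y) := by
  have hshift : ContDiff ℝ 2 fun z => f (x + z) := hf.comp (contDiff_const.add contDiff_id)
  rw [laplacian_eq_sum_fderiv_fderiv (stdOrthonormalBasis ℝ V) hshift,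
    laplacian_eq_sum_fderiv_fderiv (stdOrthonormalBasis ℝ V) hf]
  refine Finset.sum_congr rfl fun i _ => ?_
  simp only [fderiv_comp_add_left]
  rw [fderiv_comp_add_left (f := fun y => fderiv ℝ f y _)]

theorem sum_fderiv_mul_fderiv_eq_inner_gradient {ι : Type*} [Fintype ι]
    (b : OrthonormalBasis ι ℝ V) (f g : V → ℝ) (x : V) :
    ∑ i, fderiv ℝ g x (b i) * fderiv ℝ f x (b i) = inner ℝ (∇ g x) (∇ f x) := by
  rw [← b.sum_inner_mul_inner]
  exact Finset.sum_congr rfl fun i _ => by rw [inner_gradient_left, inner_gradient_right]; rfl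

variable [MeasurableSpace V] [BorelSpace V] (μ : Measure V) [μ.IsAddHaarMeasure]

theorem integral_mul_laplacian {f g : V → ℝ} (hg : ContDiff ℝ 1 g) (hf : ContDiff ℝ 2 f)
    (hsupp : HasCompactSupport g ∨ HasCompactSupport f) :
    ∫ x, g x * (Δ f) x ∂μ = -∫ x, inner ℝ (∇ g x) (∇ f x) ∂μ := by
  let b := stdOrthonormalBasis ℝ V
  have hf' i : ContDiff ℝ 1 fun y => fderiv ℝ f y (b i) := contDiff_fderiv_apply hf _
  have hf'' i : Continuous fun x => fderiv ℝ (fun y => fderiv ℝ f y (b i)) x (b i) :=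
    ((hf' i).continuous_fderiv (by norm_num)).clm_apply continuous_const
  have hg' i : Continuous fun y => fderiv ℝ g y (b i) :=
    (hg.continuous_fderiv (by norm_num)).clm_apply continuous_const
  have hint₀ i : Integrable (fun x => g x * fderiv ℝ f x (b i)) μ :=
    (hg.continuous.mul (hf' i).continuous).integrable_of_hasCompactSupport <|
      hsupp.elim (·.mul_right) fun h => (h.fderiv_apply ℝ _).mul_left
  have hint₁ i : Integrable (fun x => fderiv ℝ g x (b i) * fderiv ℝ f x (b i)) μ :=
    ((hg' i).mul (hf' i).continuous).integrable_of_hasCompactSupport <|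
      hsupp.elim (fun h => (h.fderiv_apply ℝ _).mul_right) fun h => (h.fderiv_apply ℝ _).mul_left
  have hint₂ i :
      Integrable (fun x => g x * fderiv ℝ (fun y => fderiv ℝ f y (b i)) x (b i)) μ :=
    (hg.continuous.mul (hf'' i)).integrable_of_hasCompactSupport <|
      hsupp.elim (·.mul_right) fun h => ((h.fderiv_apply ℝ _).fderiv_apply ℝ _).mul_left
  simp only [laplacian_eq_sum_fderiv_fderiv b hf, Finset.mul_sum,
    ← sum_fderiv_mul_fderiv_eq_inner_gradient b]
  rw [integral_finsetSum _ fun i _ => hint₂ i, integral_finsetSum _ fun i _ => hint₁ i,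
    ← Finset.sum_neg_distrib]
  exact Finset.sum_congr rfl fun i _ => integral_mul_fderiv_eq_neg_fderiv_mul_of_integrable
    (hint₁ i) (hint₂ i) (hint₀ i) (fun x _ => hg.differentiable (by norm_num) x)
    fun x _ => (hf' i).differentiable (by norm_num) x

theorem integral_mul_laplacian_comm {f g : V → ℝ} (hf : ContDiff ℝ 2 f) (hg : ContDiff ℝ 2 g)
    (hsupp : HasCompactSupport g) : ∫ x, f x * (Δ g) x ∂μ = ∫ x, g x * (Δ f) x ∂μ := by
  rw [integral_mul_laplacian μ (hf.of_le (by norm_num)) hg (.inr hsupp),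
    integral_mul_laplacian μ (hg.of_le (by norm_num)) hf (.inl hsupp)]
  simp only [real_inner_comm]

end Laplacian

section DivergenceTheorem

theorem hasDerivAt_integral_sq_sub_sq_mul {p : ℝ → ℝ} (hp : Continuous p) (T : ℝ) :
    HasDerivAt (fun T => ∫ s in 0..T, (T ^ 2 - s ^ 2) * p s) (2 * T * ∫ s in 0..T, p s) T := by
  have hsq : Continuous fun s => s ^ 2 * p s := by fun_prop
  have hexpand : (fun T => ∫ s in 0..T, (T ^ 2 - s ^ 2) * p s) =
      fun T => T ^ 2 * (∫ s in 0..T, p s) - ∫ s in 0..T, s ^ 2 * p s := by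
    funext T
    simp only [sub_mul]
    rw [intervalIntegral.integral_sub ((hp.const_mul _).intervalIntegrable _ _)
      (hsq.intervalIntegrable _ _), intervalIntegral.integral_const_mul]
  rw [hexpand]
  exact (((hasDerivAt_pow 2 T).mul (hp.integral_hasStrictDerivAt 0 T).hasDerivAt).sub
    (hsq.integral_hasStrictDerivAt 0 T).hasDerivAt).congr_deriv (by push_cast; ring)

theorem hasDerivAt_integral_sq_sub_sq_sq_mul {p : ℝ → ℝ} (hp : Continuous p) (T : ℝ) :
    HasDerivAt (fun T => ∫ s in 0..T, (T ^ 2 - s ^ 2) ^ 2 * p s)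
      (4 * T * ∫ s in 0..T, (T ^ 2 - s ^ 2) * p s) T := by
  have hsq : Continuous fun s => s ^ 2 * p s := by fun_prop
  have hsub (T : ℝ) : Continuous fun s => (T ^ 2 - s ^ 2) * p s := by fun_prop
  have hexpand : (fun T => ∫ s in 0..T, (T ^ 2 - s ^ 2) ^ 2 * p s) =
      fun T => T ^ 2 * (∫ s in 0..T, (T ^ 2 - s ^ 2) * p s) -
        ∫ s in 0..T, (T ^ 2 - s ^ 2) * (s ^ 2 * p s) := by
    funext T
    rw [← intervalIntegral.integral_const_mul, ← intervalIntegral.integral_sub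
      (((hsub T).const_mul _).intervalIntegrable _ _)
      ((by fun_prop : Continuous fun s => (T ^ 2 - s ^ 2) * (s ^ 2 * p s)).intervalIntegrable _ _)]
    exact intervalIntegral.integral_congr fun s _ => by ring
  rw [hexpand]
  refine (((hasDerivAt_pow 2 T).mul (hasDerivAt_integral_sq_sub_sq_mul hp T)).sub
    (hasDerivAt_integral_sq_sub_sq_mul hsq T)).congr_deriv ?_
  simp only [sub_mul]
  rw [intervalIntegral.integral_sub ((hp.const_mul _).intervalIntegrable _ _)
    (hsq.intervalIntegrable _ _), intervalIntegral.integral_const_mul]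
  push_cast
  ring

theorem eq_integral_of_forall_integral_sq_sub_sq_eq {p q : ℝ → ℝ} (hp : Continuous p)
    (hq : Continuous q)
    (h : ∀ T > 0, ∫ s in 0..T, (T ^ 2 - s ^ 2) ^ 2 * p s =
      4 * ∫ s in 0..T, (T ^ 2 - s ^ 2) * (s * q s)) {T : ℝ} (hT : 0 < T) :
    q T = ∫ s in 0..T, p s := by
  have hsq : Continuous fun s => s * q s := by fun_prop
  have hfirst {T : ℝ} (hT : 0 < T) :
      ∫ s in 0..T, (T ^ 2 - s ^ 2) * p s = 2 * ∫ s in 0..T, s * q s := by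
    have hderiv := (hasDerivAt_integral_sq_sub_sq_sq_mul hp T).unique <|
      ((hasDerivAt_integral_sq_sub_sq_mul hsq T).const_mul 4).congr_of_eventuallyEq <|
        (eventually_gt_nhds hT).mono h
    exact mul_left_cancel₀ (by positivity : 4 * T ≠ 0) (by linear_combination hderiv)
  have hderiv := (hasDerivAt_integral_sq_sub_sq_mul hp T).unique <|
    ((hsq.integral_hasStrictDerivAt 0 T).hasDerivAt.const_mul 2).congr_of_eventuallyEq <|
      (eventually_gt_nhds hT).mono fun _ => hfirst
  exact mul_left_cancel₀ (by positivity : 2 * T ≠ 0) (by linear_combination -hderiv)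

theorem hasDerivAt_max_zero_sq (u : ℝ) :
    HasDerivAt (fun u : ℝ => max 0 u ^ 2) (2 * max 0 u) u := by
  have hremainder (v : ℝ) :
      ‖max 0 v ^ 2 - max 0 u ^ 2 - 2 * max 0 u * (v - u)‖ ≤ 1 * ‖‖v - u‖ ^ 2‖ := by
    rw [one_mul, norm_pow, norm_norm, Real.norm_eq_abs, Real.norm_eq_abs, sq_abs, abs_le]
    rcases le_total 0 u with hu | hu <;> rcases le_total 0 v with hv | hv <;>
      simp only [max_eq_right, max_eq_left, hu, hv] <;> constructor <;> nlinarith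
  have hzero := (Asymptotics.IsBigO.of_bound 1 (Eventually.of_forall hremainder)).hasFDerivAt
    one_lt_two |>.hasDerivAt
  have hlin : HasDerivAt (fun v => 2 * max 0 u * (v - u)) (2 * max 0 u) u := by
    simpa using ((hasDerivAt_id u).sub_const u).const_mul (2 * max 0 u)
  simpa using (hzero.add hlin).add_const (max 0 u ^ 2)

variable {V : Type*} [NormedAddCommGroup V] [InnerProductSpace ℝ V] [FiniteDimensional ℝ V]

theorem hasGradientAt_max_zero_sq_sub_norm_sq_sq (T : ℝ) (x : V) :
    HasGradientAt (fun x : V => max 0 (T ^ 2 - ‖x‖ ^ 2) ^ 2)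
      (-(4 * max 0 (T ^ 2 - ‖x‖ ^ 2)) • x) x := by
  rw [hasGradientAt_iff_hasFDerivAt]
  refine ((hasDerivAt_max_zero_sq (T ^ 2 - ‖x‖ ^ 2)).comp_hasFDerivAt x
    ((hasStrictFDerivAt_norm_sq x).hasFDerivAt.const_sub (T ^ 2))).congr_fderiv ?_
  ext v
  simp
  ring

end DivergenceTheorem

section SphereIntegral

variable {V : Type*} [NormedAddCommGroup V] [InnerProductSpace ℝ V] [FiniteDimensional ℝ V]
  [MeasurableSpace V] [BorelSpace V]

/-- The unnormalized integral of `f` over the sphere of centre `x` and radius `r`, transported to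
the unit sphere with its surface measure. -/
def sphereIntegral (f : V → ℝ) (x : V) (r : ℝ) : ℝ :=
  ∫ ω, f (x + r • (ω : V)) ∂(volume : Measure V).toSphere

theorem integral_ball_sq_sub_norm_sq_sq_mul_laplacian (μ : Measure V) [μ.IsAddHaarMeasure]
    {f : V → ℝ} (hf : ContDiff ℝ 2 f) {T : ℝ} (hT : 0 ≤ T) :
    ∫ x in ball 0 T, (T ^ 2 - ‖x‖ ^ 2) ^ 2 * (Δ f) x ∂μ =
      4 * ∫ x in ball 0 T, (T ^ 2 - ‖x‖ ^ 2) * fderiv ℝ f x x ∂μ := by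
  let w : V → ℝ := fun x => max 0 (T ^ 2 - ‖x‖ ^ 2)
  have hw_mem {x : V} (hx : x ∈ ball 0 T) : w x = T ^ 2 - ‖x‖ ^ 2 :=
    max_eq_right (sub_nonneg.2 (by gcongr; exact (mem_ball_zero_iff.1 hx).le))
  have hw_notMem {x : V} (hx : x ∉ ball 0 T) : w x = 0 :=
    max_eq_left (sub_nonpos.2 (by gcongr; simpa using hx))
  have hw : Continuous w := by fun_prop
  have hgrad (x : V) : HasGradientAt (fun x => w x ^ 2) (-(4 * w x) • x) x :=
    hasGradientAt_max_zero_sq_sub_norm_sq_sq T x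
  have hw_sq : ContDiff ℝ 1 fun x => w x ^ 2 :=
    contDiff_one_iff_fderiv.2 ⟨fun x => (hgrad x).differentiableAt, by
      rw [funext fun x => (hgrad x).hasFDerivAt.fderiv]
      fun_prop⟩
  have hsupp : HasCompactSupport fun x => w x ^ 2 :=
    .intro (isCompact_closedBall 0 T) fun x hx => by
      rw [hw_notMem fun h => hx (ball_subset_closedBall h), zero_pow two_ne_zero]
  calc ∫ x in ball 0 T, (T ^ 2 - ‖x‖ ^ 2) ^ 2 * (Δ f) x ∂μ
      = ∫ x in ball 0 T, w x ^ 2 * (Δ f) x ∂μ :=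
        setIntegral_congr_fun measurableSet_ball fun x hx => by simp only [hw_mem hx]
    _ = ∫ x, w x ^ 2 * (Δ f) x ∂μ :=
        setIntegral_eq_integral_of_forall_compl_eq_zero fun x hx => by simp [hw_notMem hx]
    _ = ∫ x, 4 * (w x * fderiv ℝ f x x) ∂μ := by
        rw [integral_mul_laplacian μ hw_sq hf (.inl hsupp), ← integral_neg]
        refine integral_congr_ae (.of_forall fun x => ?_)
        simp [(hgrad x).gradient, inner_gradient_right, mul_assoc]
    _ = 4 * ∫ x in ball 0 T, w x * fderiv ℝ f x x ∂μ := by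
        rw [integral_const_mul, setIntegral_eq_integral_of_forall_compl_eq_zero]
        exact fun x hx => by simp [hw_notMem hx]
    _ = 4 * ∫ x in ball 0 T, (T ^ 2 - ‖x‖ ^ 2) * fderiv ℝ f x x ∂μ := by
        rw [setIntegral_congr_fun measurableSet_ball fun x hx => by rw [hw_mem hx]]

theorem sphereIntegral_zero_radius (f : V → ℝ) (x : V) :
    sphereIntegral f x 0 = (volume : Measure V).toSphere.real univ * f x := by
  simp [sphereIntegral]

theorem integrable_comp_unitSphere {f : V → ℝ} (hf : Continuous f) (x : V) (r : ℝ) :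
    Integrable (fun ω : sphere (0 : V) 1 => f (x + r • (ω : V))) (volume : Measure V).toSphere :=
  Continuous.integrable_of_hasCompactSupport (by fun_prop) (.of_compactSpace _)

theorem continuous_sphereIntegral {f : V → ℝ} (hf : Continuous f) (x : V) :
    Continuous (sphereIntegral f x) := by
  have hint := continuous_parametric_integral_of_continuous (μ := (volume : Measure V).toSphere)
    (f := fun (r : ℝ) (ω : sphere (0 : V) 1) => f (x + r • (ω : V)))
    (by simp only [Function.uncurry_def]; fun_prop) isCompact_univ
  simpa only [Measure.restrict_univ] using! hint

theorem continuous_integral_fderiv_unitSphere {f : V → ℝ} (hf : ContDiff ℝ 1 f) :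
    Continuous fun r : ℝ =>
      ∫ ω, fderiv ℝ f (r • (ω : V)) ω ∂(volume : Measure V).toSphere := by
  have := hf.continuous_fderiv (by norm_num)
  have hint := continuous_parametric_integral_of_continuous (μ := (volume : Measure V).toSphere)
    (f := fun (r : ℝ) (ω : sphere (0 : V) 1) => fderiv ℝ f (r • (ω : V)) ω)
    (by simp only [Function.uncurry_def]; fun_prop) isCompact_univ
  simpa using hint

theorem hasDerivAt_sphereIntegral_zero {f : V → ℝ} (hf : ContDiff ℝ 1 f) (r : ℝ) :
    HasDerivAt (sphereIntegral f 0)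
      (∫ ω, fderiv ℝ f (r • (ω : V)) ω ∂(volume : Measure V).toSphere) r := by
  have := hf.continuous_fderiv (by norm_num)
  have hcont : Continuous fun p : ℝ × sphere (0 : V) 1 => fderiv ℝ f (p.1 • (p.2 : V)) p.2 := by
    fun_prop
  obtain ⟨C, hC⟩ := ((isCompact_closedBall r 1).prod isCompact_univ).exists_bound_of_continuousOn
    hcont.continuousOn
  refine (hasDerivAt_integral_of_dominated_loc_of_deriv_le (bound := fun _ => C)
    (F' := fun s (ω : sphere (0 : V) 1) => fderiv ℝ f (s • (ω : V)) ω)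
    (closedBall_mem_nhds r one_pos)
    (.of_forall fun s => (by fun_prop : Continuous _).aestronglyMeasurable) ?_
    (by fun_prop : Continuous _).aestronglyMeasurable
    (.of_forall fun ω s hs => hC (s, ω) ⟨hs, mem_univ ω⟩) (integrable_const C)
    (.of_forall fun ω s _ => ?_)).2
  · exact (by fun_prop : Continuous _).integrable_of_hasCompactSupport (.of_compactSpace _)
  · simp only [zero_add]
    have hline : HasDerivAt (fun s : ℝ => s • (ω : V)) (ω : V) s := by
      simpa using (hasDerivAt_id s).smul_const (ω : V)
    exact (hf.differentiable (by norm_num) _).hasFDerivAt.comp_hasDerivAt s hline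

theorem integrableOn_ball_of_continuous {f : V → ℝ} (hf : Continuous f) (x : V) (r : ℝ) :
    IntegrableOn f (ball x r) :=
  (hf.continuousOn.integrableOn_compact (isCompact_closedBall x r)).mono_set ball_subset_closedBall

variable [Nontrivial V]

theorem pow_mul_integral_fderiv_unitSphere {f : V → ℝ} (hf : ContDiff ℝ 2 f) {r : ℝ}
    (hr : 0 < r) :
    r ^ (finrank ℝ V - 1) * ∫ ω, fderiv ℝ f (r • (ω : V)) ω ∂(volume : Measure V).toSphere =
      ∫ x in ball (0 : V) r, (Δ f) x := by
  have hL : Continuous fun s => s ^ (finrank ℝ V - 1) * sphereIntegral (Δ f) 0 s :=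
    (continuous_pow _).mul (continuous_sphereIntegral (continuous_laplacian hf) 0)
  have hΦ : Continuous fun s : ℝ => s ^ (finrank ℝ V - 1) *
      ∫ ω, fderiv ℝ f (s • (ω : V)) ω ∂(volume : Measure V).toSphere :=
    (continuous_pow _).mul (continuous_integral_fderiv_unitSphere (hf.of_le (by norm_num)))
  have hf' := hf.continuous_fderiv (by norm_num)
  have hΔ := continuous_laplacian hf
  rw [eq_integral_of_forall_integral_sq_sub_sq_eq hL hΦ (fun T hT => ?_) hr,
    setIntegral_ball_polar volume (integrableOn_ball_of_continuous hΔ 0 r) hr.le]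
  · simp only [sphereIntegral, zero_add, smul_eq_mul]
  have hgreen := integral_ball_sq_sub_norm_sq_sq_mul_laplacian volume hf hT.le
  have hpolar {h : V → ℝ} (hh : Continuous h) :=
    setIntegral_ball_polar volume (integrableOn_ball_of_continuous hh 0 T) hT.le
  rw [hpolar (by fun_prop), hpolar (by fun_prop)] at hgreen
  convert hgreen using 1
  · refine intervalIntegral.integral_congr fun s hs => ?_
    rw [uIcc_of_le hT.le] at hs
    simp only [norm_smul_unitSphere hs.1, integral_const_mul, smul_eq_mul, sphereIntegral,
      zero_add]
    ring
  · congr 1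
    refine intervalIntegral.integral_congr fun s hs => ?_
    rw [uIcc_of_le hT.le] at hs
    simp only [norm_smul_unitSphere hs.1, integral_const_mul, smul_eq_mul, map_smul]
    ring

theorem hasDerivAt_sphereIntegral {f : V → ℝ} (hf : ContDiff ℝ 2 f) (x : V) {r : ℝ}
    (hr : 0 < r) :
    HasDerivAt (sphereIntegral f x)
      ((r ^ (finrank ℝ V - 1))⁻¹ * ∫ y in ball x r, (Δ f) y) r := by
  have hshift : ContDiff ℝ 2 fun y => f (x + y) := hf.comp (contDiff_const.add contDiff_id)
  have hball : ∫ y in ball x r, (Δ f) y = ∫ y in ball 0 r, (Δ fun z => f (x + z)) y := by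
    simp only [laplacian_comp_add_left hf]
    rw [← (measurePreserving_add_left volume x).setIntegral_preimage_emb
      (measurableEmbedding_addLeft x), preimage_add_ball, sub_self]
  rw [hball, ← pow_mul_integral_fderiv_unitSphere hshift hr, inv_mul_cancel_left₀ (by positivity)]
  convert hasDerivAt_sphereIntegral_zero (hshift.of_le (by norm_num)) r using 1
  funext s
  simp only [sphereIntegral, zero_add]

theorem sphereIntegral_mono {f : V → ℝ} (hf : ContDiff ℝ 2 f) {x : V} {r R : ℝ} (hr : 0 ≤ r)
    (hrR : r ≤ R) (hΔ : ∀ y ∈ ball x R, 0 ≤ (Δ f) y) :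
    sphereIntegral f x r ≤ sphereIntegral f x R := by
  refine monotoneOn_of_deriv_nonneg (convex_Icc r R)
    (continuous_sphereIntegral hf.continuous x).continuousOn ?_ ?_
    (left_mem_Icc.2 hrR) (right_mem_Icc.2 hrR) hrR
  all_goals rw [interior_Icc]; intro t ht
  · exact (hasDerivAt_sphereIntegral hf x
      (hr.trans_lt ht.1)).differentiableAt.differentiableWithinAt
  · rw [(hasDerivAt_sphereIntegral hf x (hr.trans_lt ht.1)).deriv]
    have := hr.trans_lt ht.1
    exact mul_nonneg (by positivity) <| setIntegral_nonneg measurableSet_ball fun y hy =>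
      hΔ y (ball_subset_ball ht.2.le hy)

theorem laplacian_nonneg_of_le_sphereIntegral {f : V → ℝ} (hf : ContDiff ℝ 2 f) {x : V}
    (h : ∀ᶠ r in 𝓝[>] 0, sphereIntegral f x 0 ≤ sphereIntegral f x r) : 0 ≤ (Δ f) x := by
  by_contra! hneg
  obtain ⟨η, hη, hηneg⟩ := Metric.eventually_nhds_iff_ball.1
    ((continuous_laplacian hf).continuousAt.eventually_lt_const hneg)
  obtain ⟨r, hsub, hr⟩ := (h.and (Ioo_mem_nhdsGT hη)).exists
  have hanti : StrictAntiOn (sphereIntegral f x) (Icc 0 r) := by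
    refine strictAntiOn_of_deriv_neg (convex_Icc 0 r)
      (continuous_sphereIntegral hf.continuous x).continuousOn ?_
    rw [interior_Icc]
    intro t ht
    have ht₀ : 0 < t := ht.1
    rw [(hasDerivAt_sphereIntegral hf x ht₀).deriv]
    refine mul_neg_of_pos_of_neg (by positivity) (neg_pos.1 ?_)
    have hpos : ∀ y ∈ ball x t, 0 < -(Δ f) y := fun y hy =>
      neg_pos.2 (hηneg y (ball_subset_ball (ht.2.trans hr.2).le hy))
    have hint : IntegrableOn (fun y => -(Δ f) y) (ball x t) :=
      integrableOn_ball_of_continuous (continuous_laplacian hf).neg x t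
    rw [← integral_neg, setIntegral_pos_iff_support_of_nonneg_ae
      ((ae_restrict_iff' measurableSet_ball).2 (.of_forall fun y hy => (hpos y hy).le)) hint]
    exact (measure_ball_pos volume x ht₀).trans_le
      (measure_mono fun y hy => ⟨(hpos y hy).ne', hy⟩)
  exact hsub.not_gt (hanti (left_mem_Icc.2 hr.1.le) (right_mem_Icc.2 hr.1.le) hr.1)

end SphereIntegral

section ExtendedRealIntegral

variable {α : Type*} [MeasurableSpace α] {μ : Measure α} {f : α → EReal}

/-- Integrability of an extended-real function: it is almost everywhere finite, and its real part
is integrable. This makes `extIntegral μ f` the Bochner integral of the real part. -/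
structure ERealIntegrable (f : α → EReal) (μ : Measure α) : Prop where
  ae_eq_coe : ∀ᵐ x ∂μ, f x = (f x).toReal
  integrable : Integrable (fun x => (f x).toReal) μ

theorem ERealIntegrable.mono_measure {ν : Measure α} (hf : ERealIntegrable f μ) (hνμ : ν ≤ μ) :
    ERealIntegrable f ν :=
  ⟨ae_mono hνμ hf.ae_eq_coe, hf.integrable.mono_measure hνμ⟩

theorem ERealIntegrable.ae_ne_bot (hf : ERealIntegrable f μ) : ∀ᵐ x ∂μ, f x ≠ ⊥ :=
  hf.ae_eq_coe.mono fun _ hx => hx ▸ EReal.coe_ne_bot _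

theorem ERealIntegrable.congr {g : α → EReal} (hf : ERealIntegrable f μ) (hfg : f =ᵐ[μ] g) :
    ERealIntegrable g μ :=
  ⟨by filter_upwards [hf.ae_eq_coe, hfg] with x hx hfgx using hfgx ▸ hx,
    hf.integrable.congr (hfg.mono fun _ hx => congrArg EReal.toReal hx)⟩

theorem extIntegral_eq_integral {g : α → ℝ} (hg : Integrable g μ) (hfg : ∀ᵐ x ∂μ, f x = g x) :
    extIntegral μ f = ((∫ x, g x ∂μ : ℝ) : EReal) := by
  have hpos : ∫⁻ x, (f x).toENNReal ∂μ = ∫⁻ x, ENNReal.ofReal (g x) ∂μ :=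
    lintegral_congr_ae (hfg.mono fun x hx => by simp only [hx, EReal.real_coe_toENNReal])
  have hneg : ∫⁻ x, (-f x).toENNReal ∂μ = ∫⁻ x, ENNReal.ofReal (-g x) ∂μ :=
    lintegral_congr_ae <| hfg.mono fun x hx => by
      simp only [hx, ← EReal.coe_neg, EReal.real_coe_toENNReal]
  have hfin : ∫⁻ x, ENNReal.ofReal (-g x) ∂μ ≠ ⊤ := hg.neg.lintegral_lt_top.ne
  rw [extIntegral, hpos, hneg, integral_eq_lintegral_pos_part_sub_lintegral_neg_part hg,
    EReal.coe_sub, EReal.coe_ennreal_toReal hg.lintegral_lt_top.ne,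
    EReal.coe_ennreal_toReal hfin]

theorem ERealIntegrable.extIntegral_eq (hf : ERealIntegrable f μ) :
    extIntegral μ f = ((∫ x, (f x).toReal ∂μ : ℝ) : EReal) :=
  extIntegral_eq_integral hf.integrable hf.ae_eq_coe

theorem erealIntegrable_of_lintegral_const_sub_ne_top [IsFiniteMeasure μ] (hf : Measurable f)
    {C : ℝ} (hC : ∀ᵐ x ∂μ, f x ≤ C) (h : ∫⁻ x, (C - f x).toENNReal ∂μ ≠ ⊤) :
    ERealIntegrable f μ := by
  have hcoe : ∀ᵐ x ∂μ, f x = (f x).toReal := by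
    filter_upwards [ae_lt_top (by fun_prop) h, hC] with x hx hCx
    refine (EReal.coe_toReal (hCx.trans_lt (EReal.coe_lt_top C)).ne fun hbot => ?_).symm
    simp [hbot] at hx
  refine ⟨hcoe, hf.ereal_toReal.aestronglyMeasurable, ?_⟩
  have hbound : ∀ᵐ x ∂μ, ‖(f x).toReal‖ₑ ≤ ENNReal.ofReal |C| + (C - f x).toENNReal := by
    filter_upwards [hcoe, hC] with x hx hCx
    rw [hx, EReal.coe_le_coe_iff] at hCx
    rw [hx, EReal.toReal_coe, ← EReal.coe_sub, EReal.real_coe_toENNReal,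
      ← ENNReal.ofReal_add (abs_nonneg C) (sub_nonneg.2 hCx), Real.enorm_eq_ofReal_abs]
    refine ENNReal.ofReal_le_ofReal (abs_le.2 ⟨?_, ?_⟩) <;> linarith [le_abs_self C, neg_abs_le C]
  rw [hasFiniteIntegral_iff_enorm]
  refine (lintegral_mono_ae hbound).trans_lt ?_
  rw [lintegral_add_left measurable_const, lintegral_const]
  exact ENNReal.add_lt_top.2
    ⟨ENNReal.mul_lt_top ENNReal.ofReal_lt_top (measure_lt_top _ _), h.lt_top⟩

theorem erealIntegrable_of_extIntegral_ne_bot [IsFiniteMeasure μ] (hf : Measurable f) {C : ℝ}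
    (hC : ∀ x, f x ≤ C) (h : extIntegral μ f ≠ ⊥) : ERealIntegrable f μ := by
  have hneg : ∫⁻ x, (-f x).toENNReal ∂μ ≠ ⊤ := fun htop => h (by simp [extIntegral, htop])
  refine erealIntegrable_of_lintegral_const_sub_ne_top hf (.of_forall hC) (ne_top_of_le_ne_top ?_
    (lintegral_mono fun x => (EReal.toENNReal_add_le : ((C : EReal) + -f x).toENNReal ≤ _)))
  rw [lintegral_add_left measurable_const, lintegral_const]
  exact ENNReal.add_ne_top.2
    ⟨ENNReal.mul_ne_top (by simp) (measure_ne_top _ _), hneg⟩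

end ExtendedRealIntegral

section SphereArea

variable {d : ℕ} [NeZero d]

theorem sphereArea_pos : 0 < sphereArea d := by
  have hd : (0 : ℝ) < d / 2 := by have := NeZero.pos d; positivity
  have := Real.Gamma_pos_of_pos hd
  rw [sphereArea]
  positivity

theorem toSphere_real_univ : (volume : Measure (E d)).toSphere.real univ = sphereArea d := by
  have hd : (0 : ℝ) < d / 2 := by have := NeZero.pos d; positivity
  have := Real.Gamma_pos_of_pos hd
  rw [Measure.real, Measure.toSphere_apply_univ, EuclideanSpace.volume_ball]
  simp only [finrank_euclideanSpace, Fintype.card_fin, ENNReal.ofReal_one, one_pow, one_mul]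
  rw [ENNReal.toReal_mul, ENNReal.toReal_natCast, ENNReal.toReal_ofReal (by positivity),
    Real.Gamma_add_one hd.ne', sphereArea, Real.sqrt_eq_rpow, ← Real.rpow_natCast,
    ← Real.rpow_mul Real.pi_pos.le, one_div_mul_eq_div]
  have hd0 : (d : ℝ) ≠ 0 := NeZero.ne _
  field_simp

end SphereArea

namespace SubharmonicOn

variable {d : ℕ} {u : E d → EReal} {Ω : Set (E d)}

theorem measurable_indicator (hu : SubharmonicOn u Ω) (hΩ : IsOpen Ω) :
    Measurable (Ω.indicator u) := by
  refine measurable_of_restrict_of_restrict_compl hΩ.measurableSet ?_ ?_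
  · convert (upperSemicontinuousOn_iff_restrict.2 hu.upperSemicontinuousOn).measurable using 1
    ext x
    simp
  · convert measurable_const (a := (0 : EReal)) using 1
    ext x
    exact indicator_of_notMem x.2 u

theorem exists_forall_le (hu : SubharmonicOn u Ω) {K : Set (E d)} (hK : IsCompact K)
    (hKΩ : K ⊆ Ω) : ∃ C : ℝ, ∀ x ∈ K, u x ≤ C := by
  rcases K.eq_empty_or_nonempty with rfl | hne
  · exact ⟨0, by simp⟩
  obtain ⟨a, ha, hmax⟩ := (hu.upperSemicontinuousOn.mono hKΩ).exists_isMaxOn hne hK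
  exact ⟨(u a).toReal, fun x hx => (hmax hx).trans (EReal.le_coe_toReal (hu.lt_top a (hKΩ ha)).ne)⟩

theorem measurable_comp_unitSphere (hu : SubharmonicOn u Ω) (hΩ : IsOpen Ω) {x : E d} {r : ℝ}
    (hr : 0 ≤ r) (hxr : closedBall x r ⊆ Ω) :
    Measurable fun ω : sphere (0 : E d) 1 => u (x + r • (ω : E d)) := by
  have hind : (fun ω : sphere (0 : E d) 1 => u (x + r • (ω : E d))) =
      fun ω : sphere (0 : E d) 1 => Ω.indicator u (x + r • (ω : E d)) := funext fun ω =>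
    (indicator_of_mem (hxr (add_smul_unitSphere_mem_closedBall x hr ω)) u).symm
  rw [hind]
  exact (hu.measurable_indicator hΩ).comp (by fun_prop)

variable [NeZero d]

theorem erealIntegrable_unitSphere (hu : SubharmonicOn u Ω) (hΩ : IsOpen Ω) {x : E d} {r : ℝ}
    (hr : 0 < r) (hxr : closedBall x r ⊆ Ω) (hx : u x ≠ ⊥) :
    ERealIntegrable (fun ω : sphere (0 : E d) 1 => u (x + r • (ω : E d)))
      (volume : Measure (E d)).toSphere := by
  obtain ⟨C, hC⟩ := hu.exists_forall_le (isCompact_closedBall x r) hxr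
  refine erealIntegrable_of_extIntegral_ne_bot (hu.measurable_comp_unitSphere hΩ hr.le hxr)
    (fun ω => hC _ (add_smul_unitSphere_mem_closedBall x hr.le ω)) fun hbot => hx ?_
  have hle := hu.le_sphereMean x (hxr (mem_closedBall_self hr.le)) r hr hxr
  rwa [sphereMean, hbot, EReal.coe_mul_bot_of_pos (inv_pos.2 sphereArea_pos), le_bot_iff] at hle

theorem sphereArea_mul_le_sphereIntegral (hu : SubharmonicOn u Ω) (hΩ : IsOpen Ω) {x : E d}
    {r : ℝ} (hr : 0 < r) (hxr : closedBall x r ⊆ Ω) (hx : u x ≠ ⊥) :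
    sphereArea d * (u x).toReal ≤ sphereIntegral (fun y => (u y).toReal) x r := by
  have hxΩ : x ∈ Ω := hxr (mem_closedBall_self hr.le)
  have hle := hu.le_sphereMean x hxΩ r hr hxr
  rw [sphereMean, (hu.erealIntegrable_unitSphere hΩ hr hxr hx).extIntegral_eq, ← EReal.coe_mul,
    ← EReal.coe_toReal (hu.lt_top x hxΩ).ne hx, EReal.coe_le_coe_iff] at hle
  exact (le_inv_mul_iff₀ sphereArea_pos).1 hle

theorem lintegral_unitSphere_const_sub_le (hu : SubharmonicOn u Ω) (hΩ : IsOpen Ω) {x : E d}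
    {r : ℝ} (hr : 0 < r) (hxr : closedBall x r ⊆ Ω) (hx : u x ≠ ⊥) {C : ℝ}
    (hC : ∀ y ∈ closedBall x r, u y ≤ C) :
    ∫⁻ ω, (C - u (x + r • (ω : E d))).toENNReal ∂(volume : Measure (E d)).toSphere ≤
      ENNReal.ofReal (sphereArea d * (C - (u x).toReal)) := by
  have hint := hu.erealIntegrable_unitSphere hΩ hr hxr hx
  have hnonneg : ∀ᵐ ω : sphere (0 : E d) 1 ∂(volume : Measure (E d)).toSphere,
      0 ≤ C - (u (x + r • (ω : E d))).toReal := by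
    filter_upwards [hint.ae_eq_coe] with ω hω
    have hle := hC _ (add_smul_unitSphere_mem_closedBall x hr.le ω)
    rw [hω, EReal.coe_le_coe_iff] at hle
    exact sub_nonneg.2 hle
  calc ∫⁻ ω, (C - u (x + r • (ω : E d))).toENNReal ∂(volume : Measure (E d)).toSphere
      = ∫⁻ ω, ENNReal.ofReal (C - (u (x + r • (ω : E d))).toReal)
          ∂(volume : Measure (E d)).toSphere :=
        lintegral_congr_ae <| hint.ae_eq_coe.mono fun ω hω => by
          simp only
          rw [hω, ← EReal.coe_sub, EReal.real_coe_toENNReal, EReal.toReal_coe]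
    _ = ENNReal.ofReal (∫ ω, (C - (u (x + r • (ω : E d))).toReal)
          ∂(volume : Measure (E d)).toSphere) :=
        (ofReal_integral_eq_lintegral_ofReal ((integrable_const C).sub hint.integrable)
          hnonneg).symm
    _ ≤ ENNReal.ofReal (sphereArea d * (C - (u x).toReal)) := by
        rw [integral_sub (integrable_const C) hint.integrable, integral_const, toSphere_real_univ,
          smul_eq_mul, mul_sub]
        gcongr
        exact hu.sphereArea_mul_le_sphereIntegral hΩ hr hxr hx

theorem erealIntegrable_ball (hu : SubharmonicOn u Ω) (hΩ : IsOpen Ω) {x : E d} {r : ℝ}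
    (hxr : closedBall x r ⊆ Ω) (hx : u x ≠ ⊥) : ERealIntegrable u (volume.restrict (ball x r)) := by
  obtain ⟨C, hC⟩ := hu.exists_forall_le (isCompact_closedBall x r) hxr
  have hind {y : E d} (hy : y ∈ closedBall x r) : Ω.indicator u y = u y :=
    indicator_of_mem (hxr hy) u
  have hmeas := hu.measurable_indicator hΩ
  have hmem : ∀ᵐ y ∂volume.restrict (ball x r), y ∈ closedBall x r :=
    (ae_restrict_mem measurableSet_ball).mono fun y hy => ball_subset_closedBall hy
  have hfin : ∫⁻ y in ball x r, (C - Ω.indicator u y).toENNReal ≠ ⊤ := by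
    rw [setLIntegral_ball_polar volume (by fun_prop)]
    refine ne_top_of_le_ne_top ?_ (setLIntegral_mono' (g := fun _ =>
      ENNReal.ofReal (r ^ (finrank ℝ (E d) - 1)) *
        ENNReal.ofReal (sphereArea d * (C - (u x).toReal))) measurableSet_Ioo fun t ht => ?_)
    · rw [setLIntegral_const]
      exact ENNReal.mul_ne_top (by finiteness) (by simp)
    have hsub : closedBall x t ⊆ closedBall x r := closedBall_subset_closedBall ht.2.le
    gcongr
    · exact ht.1.le
    · exact ht.2.le
    refine le_trans (lintegral_mono fun ω => ?_)
      (hu.lintegral_unitSphere_const_sub_le hΩ ht.1 (hsub.trans hxr) hx fun y hy => hC y (hsub hy))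
    rw [hind (hsub (add_smul_unitSphere_mem_closedBall x ht.1.le ω))]
  have : IsFiniteMeasure ((volume : Measure (E d)).restrict (ball x r)) :=
    ⟨by simpa using measure_ball_lt_top⟩
  refine (erealIntegrable_of_lintegral_const_sub_ne_top hmeas ?_ hfin).congr
    (hmem.mono fun y hy => hind hy)
  exact hmem.mono fun y hy => (hind hy).trans_le (hC y hy)

end SubharmonicOn

/-- A subharmonic function that is not identically `-∞`, on a domain. -/
structure NontrivialSubharmonicOn {d : ℕ} (u : E d → EReal) (Ω : Set (E d)) : Prop
    extends SubharmonicOn u Ω where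
  isOpen : IsOpen Ω
  isPreconnected : IsPreconnected Ω
  exists_ne_bot : ∃ x ∈ Ω, u x ≠ ⊥

namespace NontrivialSubharmonicOn

variable {d : ℕ} [NeZero d] {u : E d → EReal} {Ω : Set (E d)}

theorem exists_mem_nhds_erealIntegrable (hu : NontrivialSubharmonicOn u Ω) {x : E d} (hx : x ∈ Ω) :
    ∃ s ∈ 𝓝 x, ERealIntegrable u (volume.restrict s) := by
  let A : Set (E d) := {x | ∃ s ∈ 𝓝 x, ERealIntegrable u (volume.restrict s)}
  have hA_open : IsOpen A := isOpen_iff_eventually.2 fun y ⟨s, hs, hint⟩ =>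
    (eventually_mem_nhds_iff.2 hs).mono fun z hz => ⟨s, hz, hint⟩
  have hA_closed : closure A ∩ Ω ⊆ A := by
    rintro y ⟨hyA, hyΩ⟩
    obtain ⟨ε, hε, hεΩ⟩ := Metric.isOpen_iff.1 hu.isOpen y hyΩ
    have hε₃ : 0 < ε / 3 := by positivity
    obtain ⟨w, hwy, s, hs, hint⟩ := mem_closure_iff_nhds.1 hyA _ (ball_mem_nhds y hε₃)
    obtain ⟨δ, hδ, hδs⟩ := Metric.mem_nhds_iff.1 (inter_mem hs (isOpen_ball.mem_nhds hwy))
    obtain ⟨z, hzy, hz⟩ : ∃ z ∈ ball y (ε / 3), u z ≠ ⊥ := by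
      by_contra! hbot
      have hae : ∀ᵐ _ ∂volume.restrict (ball w δ), False := by
        filter_upwards [(hint.mono_measure (Measure.restrict_mono_set volume
          (hδs.trans inter_subset_left))).ae_ne_bot, ae_restrict_mem measurableSet_ball]
          with _ hz hzw using hz (hbot _ (hδs hzw).2)
      rw [eventually_false_iff_eq_bot, ae_eq_bot, Measure.restrict_eq_zero] at hae
      exact (measure_ball_pos volume w hδ).ne' hae
    refine ⟨ball z (ε / 2), isOpen_ball.mem_nhds ?_, hu.erealIntegrable_ball hu.isOpen ?_ hz⟩
    · rw [mem_ball, dist_comm]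
      exact (mem_ball.1 hzy).trans (by linarith)
    · exact (closedBall_subset_ball' (by linarith [mem_ball.1 hzy])).trans hεΩ
  obtain ⟨z, hzΩ, hz⟩ := hu.exists_ne_bot
  obtain ⟨ε, hε, hεΩ⟩ := nhds_basis_closedBall.mem_iff.1 (hu.isOpen.mem_nhds hzΩ)
  exact hu.isPreconnected.subset_of_closure_inter_subset hA_open
    ⟨z, hzΩ, ball z ε, ball_mem_nhds z hε, hu.erealIntegrable_ball hu.isOpen hεΩ hz⟩ hA_closed hx

theorem integrableOn_isCompact (hu : NontrivialSubharmonicOn u Ω) {K : Set (E d)} (hK : IsCompact K)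
    (hKΩ : K ⊆ Ω) : IntegrableOn (fun y => (u y).toReal) K := by
  refine LocallyIntegrableOn.integrableOn_compact_subset (fun x hx => ?_) hKΩ hK
  obtain ⟨s, hs, hint⟩ := hu.exists_mem_nhds_erealIntegrable hx
  exact ⟨s, mem_nhdsWithin_of_mem_nhds hs, hint.integrable⟩

theorem ae_ne_bot (hu : NontrivialSubharmonicOn u Ω) : ∀ᵐ x, x ∈ Ω → u x ≠ ⊥ := by
  refine measure_null_of_locally_null _ fun x hx => ?_
  have hxΩ : x ∈ Ω := by_contra fun h => hx fun hxΩ => absurd hxΩ h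
  obtain ⟨s, hs, hint⟩ := hu.exists_mem_nhds_erealIntegrable hxΩ
  obtain ⟨δ, hδ, hδs⟩ := Metric.mem_nhds_iff.1 hs
  have hae := (hint.mono_measure (Measure.restrict_mono_set volume hδs)).ae_ne_bot
  rw [ae_restrict_iff' measurableSet_ball] at hae
  refine ⟨_, inter_mem_nhdsWithin _ (ball_mem_nhds x hδ), measure_mono_null ?_ hae⟩
  exact fun y hy hyball => hy.1 fun _ => hyball hy.2

end NontrivialSubharmonicOn

section Mollifier

variable {V : Type*} [NormedAddCommGroup V] {ε : ℝ} {x : V}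

theorem smoothTransition_one_sub_eq_zero (hε : 0 < ε) (hx : ε ≤ ‖x‖) :
    Real.smoothTransition (1 - ‖x‖ ^ 2 / ε ^ 2) = 0 := by
  refine Real.smoothTransition.zero_of_nonpos (sub_nonpos.2 ?_)
  rw [one_le_div (by positivity)]
  gcongr

variable [InnerProductSpace ℝ V] [FiniteDimensional ℝ V] [MeasurableSpace V] [BorelSpace V]
  {w : V → ℝ} {C : ℝ}

/-- The smooth radial bump function of integral `1` supported in the closed ball of radius `ε`
centred at the origin. -/
def mollifier (ε : ℝ) (x : V) : ℝ :=
  (∫ y : V, Real.smoothTransition (1 - ‖y‖ ^ 2 / ε ^ 2))⁻¹ *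
    Real.smoothTransition (1 - ‖x‖ ^ 2 / ε ^ 2)

theorem mollifier_nonneg (ε : ℝ) (x : V) : 0 ≤ mollifier ε x :=
  mul_nonneg (inv_nonneg.2 (integral_nonneg fun _ => Real.smoothTransition.nonneg _))
    (Real.smoothTransition.nonneg _)

theorem mollifier_neg (ε : ℝ) (x : V) : mollifier ε (-x) = mollifier ε x := by
  simp only [mollifier, norm_neg]

theorem mollifier_eq_of_norm_eq {y : V} (h : ‖x‖ = ‖y‖) : mollifier ε x = mollifier ε y := by
  simp only [mollifier, h]

theorem contDiff_mollifier {n : ℕ∞} : ContDiff ℝ n (mollifier ε : V → ℝ) :=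
  contDiff_const.mul <| Real.smoothTransition.contDiff.comp <|
    contDiff_const.sub ((contDiff_norm_sq ℝ).div_const _)

@[fun_prop]
theorem continuous_mollifier : Continuous (mollifier ε : V → ℝ) :=
  (contDiff_mollifier (n := 0)).continuous

theorem mollifier_eq_zero (hε : 0 < ε) (hx : ε ≤ ‖x‖) : mollifier ε x = 0 := by
  rw [mollifier, smoothTransition_one_sub_eq_zero hε hx, mul_zero]

theorem tsupport_mollifier_subset (hε : 0 < ε) :
    tsupport (mollifier ε : V → ℝ) ⊆ closedBall 0 ε := by
  refine closure_minimal (fun x hx => ?_) isClosed_closedBall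
  rw [mem_closedBall_zero_iff]
  exact not_lt.1 fun h => hx (mollifier_eq_zero hε h.le)

theorem hasCompactSupport_mollifier (hε : 0 < ε) : HasCompactSupport (mollifier ε : V → ℝ) :=
  (isCompact_closedBall (0 : V) ε).of_isClosed_subset (isClosed_tsupport _)
    (tsupport_mollifier_subset hε)

theorem integrable_mollifier (hε : 0 < ε) : Integrable (mollifier ε : V → ℝ) :=
  continuous_mollifier.integrable_of_hasCompactSupport (hasCompactSupport_mollifier hε)

theorem integral_mollifier (hε : 0 < ε) : ∫ x : V, mollifier ε x = 1 := by
  simp only [mollifier]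
  rw [integral_const_mul]
  refine inv_mul_cancel₀ (ne_of_gt ?_)
  have hcont : Continuous fun y : V => Real.smoothTransition (1 - ‖y‖ ^ 2 / ε ^ 2) :=
    Real.smoothTransition.continuous.comp (by fun_prop)
  have hsupp : HasCompactSupport fun y : V => Real.smoothTransition (1 - ‖y‖ ^ 2 / ε ^ 2) := by
    refine .of_support_subset_isCompact (isCompact_closedBall (0 : V) ε) fun y hy => ?_
    rw [mem_closedBall_zero_iff]
    exact not_lt.1 fun h => hy (smoothTransition_one_sub_eq_zero hε h.le)
  exact hcont.integral_pos_of_hasCompactSupport_nonneg_nonzero hsupp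
    (fun _ => Real.smoothTransition.nonneg _) (x := 0) (by simp)

theorem exists_mollifier_le (hε : 0 < ε) : ∃ B : ℝ, ∀ x : V, mollifier ε x ≤ B := by
  obtain ⟨B, hB⟩ := (hasCompactSupport_mollifier hε).exists_bound_of_continuous
    (continuous_mollifier (V := V))
  exact ⟨B, fun x => (Real.le_norm_self _).trans (hB x)⟩

theorem integrable_mul_mollifier (hε : 0 < ε) (hw : Integrable w) (x : V) :
    Integrable fun y => w (x + y) * mollifier ε y := by
  obtain ⟨B, hB⟩ := exists_mollifier_le (V := V) hε
  refine (hw.comp_add_left x).mul_bdd (c := B) continuous_mollifier.aestronglyMeasurable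
    (.of_forall fun y => ?_)
  rw [Real.norm_of_nonneg (mollifier_nonneg ε y)]
  exact hB y

/-- The mean of `w` around `x` with respect to the radial weight `mollifier ε`. -/
def mollify (ε : ℝ) (w : V → ℝ) : V → ℝ := w ⋆[ContinuousLinearMap.mul ℝ ℝ, volume] mollifier ε

theorem mollify_eq_integral_add (ε : ℝ) (w : V → ℝ) (x : V) :
    mollify ε w x = ∫ y, w (x + y) * mollifier ε y := by
  rw [mollify, convolution_def, ← integral_add_left_eq_self _ x]
  simp only [ContinuousLinearMap.mul_apply', sub_add_cancel_left, mollifier_neg]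

theorem contDiff_mollify {n : ℕ∞} (hε : 0 < ε) (hw : LocallyIntegrable w) :
    ContDiff ℝ n (mollify ε w) :=
  (hasCompactSupport_mollifier hε).contDiff_convolution_right _ hw contDiff_mollifier

theorem fderiv_convolution_mul_apply {χ : V → ℝ} (hw : LocallyIntegrable w)
    (hχ : ContDiff ℝ 1 χ) (hsupp : HasCompactSupport χ) (x v : V) :
    fderiv ℝ (w ⋆[ContinuousLinearMap.mul ℝ ℝ, volume] χ) x v =
      (w ⋆[ContinuousLinearMap.mul ℝ ℝ, volume] fun y => fderiv ℝ χ y v) x := by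
  rw [(hsupp.hasFDerivAt_convolution_right _ hw hχ x).fderiv]
  exact convolution_precompR_apply _ hw (hsupp.fderiv ℝ) (hχ.continuous_fderiv one_ne_zero) x v

theorem laplacian_convolution_mul {χ : V → ℝ} (hw : LocallyIntegrable w)
    (hχ : ContDiff ℝ 2 χ) (hsupp : HasCompactSupport χ) (x : V) :
    (Δ (w ⋆[ContinuousLinearMap.mul ℝ ℝ, volume] χ)) x = ∫ y, w y * (Δ χ) (x - y) := by
  let b := stdOrthonormalBasis ℝ V
  have hfderiv (v : V) : (fun x => fderiv ℝ (w ⋆[ContinuousLinearMap.mul ℝ ℝ, volume] χ) x v) =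
      w ⋆[ContinuousLinearMap.mul ℝ ℝ, volume] fun y => fderiv ℝ χ y v :=
    funext fun x => fderiv_convolution_mul_apply hw (hχ.of_le one_le_two) hsupp x v
  have hχ' (v : V) : ContDiff ℝ 1 fun y => fderiv ℝ χ y v := contDiff_fderiv_apply hχ v
  rw [laplacian_eq_sum_fderiv_fderiv b (hsupp.contDiff_convolution_right _ hw hχ)]
  simp only [hfderiv, laplacian_eq_sum_fderiv_fderiv b hχ, Finset.mul_sum]
  rw [integral_finsetSum]
  · refine Finset.sum_congr rfl fun i _ => ?_
    rw [fderiv_convolution_mul_apply hw (hχ' _) (hsupp.fderiv_apply ℝ _)]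
    rfl
  · intro i _
    exact ((hsupp.fderiv_apply ℝ (b i)).fderiv_apply ℝ (b i)).convolutionExists_right
      (ContinuousLinearMap.mul ℝ ℝ) hw
      (((hχ' _).continuous_fderiv one_ne_zero).clm_apply continuous_const) x

theorem mollify_le (hε : 0 < ε) (hw : Integrable w) (hC : ∀ᵐ y, y ∈ ball x ε → w y ≤ C) :
    mollify ε w x ≤ C := by
  have hC' : ∀ᵐ y, x + y ∈ ball x ε → w (x + y) ≤ C :=
    (measurePreserving_add_left (volume : Measure V) x).quasiMeasurePreserving.ae hC
  calc mollify ε w x = ∫ y, w (x + y) * mollifier ε y := mollify_eq_integral_add ε w x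
    _ ≤ ∫ y, C * mollifier ε y := by
        refine integral_mono_ae (integrable_mul_mollifier hε hw x)
          ((integrable_mollifier hε).const_mul C) ?_
        filter_upwards [hC'] with y hy
        obtain hyε | hyε := lt_or_ge ‖y‖ ε
        · exact mul_le_mul_of_nonneg_right (hy (by simpa using hyε)) (mollifier_nonneg ε y)
        · simp [mollifier_eq_zero hε hyε]
    _ = C := by rw [integral_const_mul, integral_mollifier hε, mul_one]

theorem integrable_prod_sphere_mul_mollifier (hε : 0 < ε) (hwm : Measurable w)
    (hw : Integrable w) (x : V) (r : ℝ) :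
    Integrable (fun p : V × sphere (0 : V) 1 => w (x + p.1 + r • (p.2 : V)) * mollifier ε p.1)
      (volume.prod (volume : Measure V).toSphere) := by
  obtain ⟨B, hB⟩ := exists_mollifier_le (V := V) hε
  have hbound (ω : sphere (0 : V) 1) :
      ∫⁻ y, ‖w (x + y + r • (ω : V)) * mollifier ε y‖ₑ ≤ (∫⁻ y, ‖w y‖ₑ) * ENNReal.ofReal B := by
    rw [← lintegral_mul_const _ (by fun_prop),
      ← lintegral_add_left_eq_self (fun y => ‖w y‖ₑ * ENNReal.ofReal B) (x + r • (ω : V))]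
    refine lintegral_mono fun y => ?_
    rw [enorm_mul, Real.enorm_eq_ofReal (mollifier_nonneg ε y), add_right_comm x y]
    gcongr
    exact hB y
  have hmeas : Measurable fun p : V × sphere (0 : V) 1 =>
      w (x + p.1 + r • (p.2 : V)) * mollifier ε p.1 :=
    (hwm.comp (by fun_prop)).mul (continuous_mollifier.measurable.comp measurable_fst)
  refine ⟨hmeas.aestronglyMeasurable, ?_⟩
  rw [hasFiniteIntegral_iff_enorm, lintegral_prod_symm' _ (by fun_prop)]
  refine (lintegral_mono hbound).trans_lt ?_
  rw [lintegral_const]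
  exact ENNReal.mul_lt_top (ENNReal.mul_lt_top (hasFiniteIntegral_iff_enorm.1 hw.2)
    ENNReal.ofReal_lt_top) (measure_lt_top _ _)

theorem integrable_sphereIntegral_mul_mollifier (hε : 0 < ε) (hwm : Measurable w)
    (hw : Integrable w) (x : V) (r : ℝ) :
    Integrable fun y => sphereIntegral w (x + y) r * mollifier ε y := by
  simpa only [sphereIntegral, integral_mul_const] using
    (integrable_prod_sphere_mul_mollifier hε hwm hw x r).integral_prod_left

theorem sphereIntegral_mollify (hε : 0 < ε) (hwm : Measurable w) (hw : Integrable w) (x : V)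
    (r : ℝ) :
    sphereIntegral (mollify ε w) x r = ∫ y, sphereIntegral w (x + y) r * mollifier ε y := by
  simp only [sphereIntegral, mollify_eq_integral_add, ← integral_mul_const]
  simp only [add_right_comm x (r • _)]
  exact (integral_integral_swap
    (f := fun y (ω : sphere (0 : V) 1) => w (x + y + r • ω) * mollifier ε y)
    (integrable_prod_sphere_mul_mollifier hε hwm hw x r)).symm

theorem le_mollify [Nontrivial V] (hε : 0 < ε) (hw : Integrable w)
    (hC : ∀ t ∈ Ioo 0 ε, 0 ≤ ∫ ω, (w (x + t • (ω : V)) - C) ∂(volume : Measure V).toSphere) :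
    C ≤ mollify ε w x := by
  have hwη := integrable_mul_mollifier hε hw x
  have hCη := (integrable_mollifier (V := V) hε).const_mul C
  have hnonneg : 0 ≤ ∫ y, (w (x + y) * mollifier ε y - C * mollifier ε y) := by
    rw [integral_polar volume (f := fun y => w (x + y) * mollifier ε y - C * mollifier ε y)
      (hwη.sub hCη)]
    refine setIntegral_nonneg measurableSet_Ioi fun t (ht : 0 < t) => ?_
    obtain ⟨e, he⟩ := exists_norm_eq V ht.le
    have hradial (ω : sphere (0 : V) 1) : mollifier ε (t • (ω : V)) = mollifier ε e :=
      mollifier_eq_of_norm_eq ((norm_smul_unitSphere ht.le ω).trans he.symm)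
    simp only [hradial, ← sub_mul, integral_mul_const]
    refine smul_nonneg (by positivity) ?_
    obtain htε | htε := lt_or_ge t ε
    · exact mul_nonneg (hC t ⟨ht, htε⟩) (mollifier_nonneg ε e)
    · rw [mollifier_eq_zero hε (he.symm ▸ htε), mul_zero]
  rw [integral_sub hwη hCη, integral_const_mul, integral_mollifier hε, mul_one,
    ← mollify_eq_integral_add] at hnonneg
  exact sub_nonneg.1 hnonneg

end Mollifier

theorem closedBall_subset_closedBall_zero {V : Type*} [SeminormedAddCommGroup V] {x : V}
    {r R : ℝ} (h : ‖x‖ + r ≤ R) : closedBall x r ⊆ closedBall 0 R :=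
  closedBall_subset_closedBall' (by rwa [dist_zero_right, add_comm])

theorem continuous_coe_sub (C : ℝ) : Continuous fun y : EReal => C - y := by
  simp only [sub_eq_add_neg]
  exact continuous_iff_continuousAt.2 fun y =>
    (EReal.continuousAt_add (.inl (EReal.coe_ne_top C)) (.inl (EReal.coe_ne_bot C))).comp
      (continuous_const.prodMk continuous_neg).continuousAt

section Regularize

variable {d : ℕ} {u : E d → EReal} {Ω : Set (E d)} {R ε r : ℝ} {x : E d}

/-- The real part of `u`, cut off outside the closed ball of radius `R` to make it integrable. -/
def truncate (u : E d → EReal) (R : ℝ) : E d → ℝ :=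
  (closedBall (0 : E d) R).indicator fun x => (u x).toReal

theorem truncate_of_mem (hx : x ∈ closedBall (0 : E d) R) : truncate u R x = (u x).toReal :=
  indicator_of_mem hx _

theorem sphereIntegral_truncate (hr : 0 ≤ r) (hx : ‖x‖ + r ≤ R) :
    sphereIntegral (truncate u R) x r = sphereIntegral (fun y => (u y).toReal) x r := by
  refine integral_congr_ae (.of_forall fun ω => truncate_of_mem ?_)
  exact closedBall_subset_closedBall_zero hx (add_smul_unitSphere_mem_closedBall x hr ω)

/-- The smooth approximation of `u` at scale `ε`; it is meaningful inside the ball of radius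
`R - ε`. -/
def regularize (u : E d → EReal) (R ε : ℝ) : E d → ℝ := mollify ε (truncate u R)

namespace NontrivialSubharmonicOn

theorem measurable_truncate (hu : NontrivialSubharmonicOn u Ω) (hR : closedBall 0 R ⊆ Ω) :
    Measurable (truncate u R) := by
  have hind : truncate u R =
      (closedBall (0 : E d) R).indicator fun x => (Ω.indicator u x).toReal :=
    indicator_congr fun x hx => by rw [indicator_of_mem (hR hx)]
  rw [hind]
  exact (hu.measurable_indicator hu.isOpen).ereal_toReal.indicator measurableSet_closedBall

variable [NeZero d]

theorem integrable_truncate (hu : NontrivialSubharmonicOn u Ω) (hR : closedBall 0 R ⊆ Ω) :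
    Integrable (truncate u R) :=
  (integrable_indicator_iff measurableSet_closedBall).2
    (hu.integrableOn_isCompact (isCompact_closedBall 0 R) hR)

theorem contDiff_regularize (hu : NontrivialSubharmonicOn u Ω) (hR : closedBall 0 R ⊆ Ω)
    (hε : 0 < ε) {n : ℕ∞} : ContDiff ℝ n (regularize u R ε) :=
  contDiff_mollify hε (hu.integrable_truncate hR).locallyIntegrable

theorem toReal_le_regularize (hu : NontrivialSubharmonicOn u Ω) (hR : closedBall 0 R ⊆ Ω)
    (hε : 0 < ε) (hx : ‖x‖ + ε ≤ R) (hxu : u x ≠ ⊥) : (u x).toReal ≤ regularize u R ε x := by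
  refine le_mollify hε (hu.integrable_truncate hR) fun t ht => ?_
  have hxt : ‖x‖ + t ≤ R := by linarith [ht.2]
  have hsub := closedBall_subset_closedBall_zero hxt
  have hint := (hu.erealIntegrable_unitSphere hu.isOpen ht.1 (hsub.trans hR) hxu).integrable
  have hmem (ω : sphere (0 : E d) 1) := hsub (add_smul_unitSphere_mem_closedBall x ht.1.le ω)
  simp only [truncate_of_mem (hmem _)]
  rw [integral_sub hint (integrable_const _), integral_const, toSphere_real_univ, smul_eq_mul]
  exact sub_nonneg.2 (hu.sphereArea_mul_le_sphereIntegral hu.isOpen ht.1 (hsub.trans hR) hxu)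

theorem sphereIntegral_zero_le_sphereIntegral_regularize (hu : NontrivialSubharmonicOn u Ω)
    (hR : closedBall 0 R ⊆ Ω) (hε : 0 < ε) (hr : 0 < r) (hx : ‖x‖ + ε + r ≤ R) :
    sphereIntegral (regularize u R ε) x 0 ≤ sphereIntegral (regularize u R ε) x r := by
  have hwm := hu.measurable_truncate hR
  have hw := hu.integrable_truncate hR
  have hne : ∀ᵐ y : E d, x + y ∈ Ω → u (x + y) ≠ ⊥ :=
    (measurePreserving_add_left (volume : Measure (E d)) x).quasiMeasurePreserving.ae hu.ae_ne_bot
  rw [regularize, sphereIntegral_mollify hε hwm hw, sphereIntegral_mollify hε hwm hw]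
  refine integral_mono_ae (integrable_sphereIntegral_mul_mollifier hε hwm hw x 0)
    (integrable_sphereIntegral_mul_mollifier hε hwm hw x r) ?_
  filter_upwards [hne] with y hy
  obtain hyε | hyε := lt_or_ge ‖y‖ ε
  · have hxyr : ‖x + y‖ + r ≤ R := by linarith [norm_add_le x y]
    have hsub := closedBall_subset_closedBall_zero hxyr
    have hxy := hsub (mem_closedBall_self hr.le)
    gcongr
    · exact mollifier_nonneg ε y
    rw [sphereIntegral_zero_radius, toSphere_real_univ, truncate_of_mem hxy,
      sphereIntegral_truncate hr.le hxyr]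
    exact hu.sphereArea_mul_le_sphereIntegral hu.isOpen hr (hsub.trans hR) (hy (hR hxy))
  · simp [mollifier_eq_zero hε hyε]

theorem laplacian_regularize_nonneg (hu : NontrivialSubharmonicOn u Ω)
    (hR : closedBall 0 R ⊆ Ω) (hε : 0 < ε) (hx : ‖x‖ + ε < R) :
    0 ≤ (Δ (regularize u R ε)) x := by
  refine laplacian_nonneg_of_le_sphereIntegral (hu.contDiff_regularize hR hε (n := 2)) ?_
  filter_upwards [Ioo_mem_nhdsGT (sub_pos.2 hx)] with r hr
  exact hu.sphereIntegral_zero_le_sphereIntegral_regularize hR hε hr.1 (by linarith [hr.2])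

theorem regularize_le (hu : NontrivialSubharmonicOn u Ω) (hR : closedBall 0 R ⊆ Ω) (hε : 0 < ε)
    (hx : ‖x‖ + ε ≤ R) {C : ℝ} (hC : ∀ y ∈ ball x ε, u y ≤ C) : regularize u R ε x ≤ C := by
  refine mollify_le hε (hu.integrable_truncate hR) ?_
  filter_upwards [hu.ae_ne_bot] with y hy hyx
  have hyR := closedBall_subset_closedBall_zero hx (ball_subset_closedBall hyx)
  rw [truncate_of_mem hyR]
  exact EReal.toReal_le_toReal (hC y hyx) (hy (hR hyR)) (EReal.coe_ne_top C)

theorem tendsto_coe_regularize (hu : NontrivialSubharmonicOn u Ω) (hR : closedBall 0 R ⊆ Ω)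
    (hx : ‖x‖ < R) :
    Tendsto (fun ε => (regularize u R ε x : EReal)) (𝓝[>] 0) (𝓝 (u x)) := by
  have hxΩ : x ∈ Ω := hR (by simpa using hx.le)
  refine tendsto_order.2 ⟨fun c hc => ?_, fun c hc => ?_⟩
  · filter_upwards [Ioo_mem_nhdsGT (sub_pos.2 hx)] with ε hε
    have hxu : u x ≠ ⊥ := (bot_le.trans_lt hc).ne'
    refine hc.trans_le ?_
    rw [← EReal.coe_toReal (hu.lt_top x hxΩ).ne hxu, EReal.coe_le_coe_iff]
    exact hu.toReal_le_regularize hR hε.1 (by linarith [hε.2]) hxu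
  · obtain ⟨c', hc', hc'c⟩ := EReal.lt_iff_exists_real_btwn.1 hc
    have husc := hu.upperSemicontinuousOn x hxΩ c' hc'
    rw [hu.isOpen.nhdsWithin_eq hxΩ] at husc
    obtain ⟨δ, hδ, hδu⟩ := Metric.eventually_nhds_iff_ball.1 husc
    filter_upwards [Ioo_mem_nhdsGT (sub_pos.2 hx), Ioo_mem_nhdsGT hδ] with ε hε hεδ
    refine lt_of_le_of_lt (EReal.coe_le_coe_iff.2 ?_) hc'c
    exact hu.regularize_le hR hε.1 (by linarith [hε.2]) fun y hy =>
      (hδu y (ball_subset_ball hεδ.2.le hy)).le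

theorem tendsto_ofReal_const_sub_regularize (hu : NontrivialSubharmonicOn u Ω)
    (hR : closedBall 0 R ⊆ Ω) (C : ℝ) (hx : ‖x‖ < R) :
    Tendsto (fun ε => ENNReal.ofReal (C - regularize u R ε x)) (𝓝[>] 0)
      (𝓝 (C - u x).toENNReal) := by
  simpa only [Function.comp_def, ← EReal.coe_sub, EReal.real_coe_toENNReal] using
    ((EReal.continuous_toENNReal.comp (continuous_coe_sub C)).tendsto _).comp
      (hu.tendsto_coe_regularize hR hx)

theorem tendsto_regularize (hu : NontrivialSubharmonicOn u Ω) (hR : closedBall 0 R ⊆ Ω)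
    (hx : ‖x‖ < R) (hxu : u x ≠ ⊥) :
    Tendsto (fun ε => regularize u R ε x) (𝓝[>] 0) (𝓝 (u x).toReal) := by
  rw [← EReal.tendsto_coe, EReal.coe_toReal (hu.lt_top x (hR (by simpa using hx.le))).ne hxu]
  exact hu.tendsto_coe_regularize hR hx

theorem exists_lintegral_sphere_const_sub_ne_top (hu : NontrivialSubharmonicOn u Ω)
    (hR : closedBall 0 R ⊆ Ω) (hr : 0 < r) (hrR : r ≤ R) (C : ℝ) :
    ∃ t ∈ Ioo 0 r,
      ∫⁻ ω, (C - u (0 + t • (ω : E d))).toENNReal ∂(volume : Measure (E d)).toSphere ≠ ⊤ := by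
  have hsub {t : ℝ} (ht : t ≤ r) : closedBall (0 : E d) t ⊆ closedBall 0 R :=
    closedBall_subset_closedBall (ht.trans hrR)
  have hmeas := hu.measurable_indicator hu.isOpen
  have hfin : ∫⁻ y in ball 0 r, (C - Ω.indicator u y).toENNReal ≠ ⊤ := by
    have hint : IntegrableOn (fun y => C - (u y).toReal) (ball (0 : E d) r) :=
      ((integrableOn_const (by simpa using measure_closedBall_lt_top.ne)).sub
        (hu.integrableOn_isCompact (isCompact_closedBall 0 R) hR)).mono_set
          (ball_subset_closedBall.trans (hsub le_rfl))
    refine ne_of_eq_of_ne (setLIntegral_congr_fun_ae measurableSet_ball ?_) hint.lintegral_lt_top.ne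
    filter_upwards [hu.ae_ne_bot] with y hy hyr
    have hyΩ : y ∈ Ω := hR (hsub le_rfl (ball_subset_closedBall hyr))
    rw [indicator_of_mem hyΩ, ← EReal.real_coe_toENNReal, EReal.coe_sub,
      EReal.coe_toReal (hu.lt_top y hyΩ).ne (hy hyΩ)]
  rw [setLIntegral_ball_polar volume (by fun_prop)] at hfin
  have hpolar_meas : Measurable fun t : ℝ => ENNReal.ofReal (t ^ (finrank ℝ (E d) - 1)) *
      ∫⁻ ω, (C - Ω.indicator u (0 + t • (ω : E d))).toENNReal
        ∂(volume : Measure (E d)).toSphere :=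
    Measurable.mul (by fun_prop) <| Measurable.lintegral_prod_right'
      (f := fun p : ℝ × sphere (0 : E d) 1 => (C - Ω.indicator u (0 + p.1 • (p.2 : E d))).toENNReal)
      (by fun_prop)
  have hnebot : (ae (volume.restrict (Ioo 0 r))).NeBot := by
    rw [ae_neBot, Ne, Measure.restrict_eq_zero]
    simp [hr]
  obtain ⟨t, ht, htr⟩ :=
    ((ae_lt_top hpolar_meas hfin).and (ae_restrict_mem measurableSet_Ioo)).exists
  refine ⟨t, htr, ne_of_eq_of_ne (lintegral_congr fun ω => ?_) (ENNReal.lt_top_of_mul_ne_top_right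
    ht.ne (ENNReal.ofReal_pos.2 (pow_pos htr.1 _)).ne').ne⟩
  rw [indicator_of_mem (hR (hsub htr.2.le (add_smul_unitSphere_mem_closedBall 0 htr.1.le ω)))]

theorem regularize_le_of_mem_closedBall (hu : NontrivialSubharmonicOn u Ω)
    (hR : closedBall 0 R ⊆ Ω) (hε : 0 < ε) (hr : r + ε ≤ R) {C : ℝ}
    (hC : ∀ y ∈ closedBall 0 R, u y ≤ C) (hx : x ∈ closedBall 0 r) : regularize u R ε x ≤ C := by
  have hxR : ‖x‖ + ε ≤ R := by linarith [mem_closedBall_zero_iff.1 hx]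
  exact hu.regularize_le hR hε hxR fun y hy =>
    hC y (closedBall_subset_closedBall_zero hxR (ball_subset_closedBall hy))

theorem lintegral_sphere_const_sub_regularize_le (hu : NontrivialSubharmonicOn u Ω)
    (hR : closedBall 0 R ⊆ Ω) (hε : 0 < ε) {C t : ℝ} (ht : 0 < t) (htr : t ≤ r) (hr : r + ε < R)
    (hC : ∀ y ∈ closedBall 0 R, u y ≤ C) :
    ∫⁻ ω, ENNReal.ofReal (C - regularize u R ε (0 + r • (ω : E d)))
        ∂(volume : Measure (E d)).toSphere ≤
      ∫⁻ ω, (C - u (0 + t • (ω : E d))).toENNReal ∂(volume : Measure (E d)).toSphere := by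
  have hsmooth := hu.contDiff_regularize hR hε (n := 2)
  have hint := integrable_comp_unitSphere hsmooth.continuous 0
  have hlintegral {s : ℝ} (hs : 0 < s) (hsr : s ≤ r) :
      ∫⁻ ω, ENNReal.ofReal (C - regularize u R ε (0 + s • (ω : E d)))
        ∂(volume : Measure (E d)).toSphere =
      ENNReal.ofReal (sphereArea d * C - sphereIntegral (regularize u R ε) 0 s) := by
    refine (ofReal_integral_eq_lintegral_ofReal ((integrable_const C).sub (hint s))
      (.of_forall fun ω => sub_nonneg.2 ?_)).symm.trans ?_
    rotate_left
    · rw [integral_sub' (integrable_const C) (hint s), integral_const, toSphere_real_univ,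
        smul_eq_mul, sphereIntegral]
    exact hu.regularize_le_of_mem_closedBall hR hε (by linarith) hC
      (add_smul_unitSphere_mem_closedBall 0 hs.le ω)
  have hmono := sphereIntegral_mono hsmooth (x := 0) ht.le htr fun x hx =>
    hu.laplacian_regularize_nonneg hR hε (by linarith [mem_ball_zero_iff.1 hx])
  calc _ ≤ ∫⁻ ω, ENNReal.ofReal (C - regularize u R ε (0 + t • (ω : E d)))
        ∂(volume : Measure (E d)).toSphere := by
        rw [hlintegral (ht.trans_le htr) le_rfl, hlintegral ht htr]
        gcongr
    _ ≤ _ := lintegral_mono fun ω => ?_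
  have htω : ‖(0 : E d) + t • (ω : E d)‖ + ε ≤ R := by
    rw [zero_add, norm_smul_unitSphere ht.le]
    linarith
  by_cases hbot : u (0 + t • (ω : E d)) = ⊥
  · rw [hbot]
    simp
  · rw [← EReal.real_coe_toENNReal, EReal.coe_sub,
      ← EReal.coe_toReal (hu.lt_top _ (hR (mem_closedBall_zero_iff.2 (by linarith)))).ne hbot]
    exact EReal.toENNReal_le_toENNReal (EReal.sub_le_sub le_rfl
      (EReal.coe_le_coe (hu.toReal_le_regularize hR hε htω hbot)))

theorem erealIntegrable_sphere (hu : NontrivialSubharmonicOn u Ω) (hR : closedBall 0 R ⊆ Ω)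
    (hr : 0 < r) (hrR : r < R) :
    ERealIntegrable (fun ω : sphere (0 : E d) 1 => u (0 + r • (ω : E d)))
      (volume : Measure (E d)).toSphere := by
  obtain ⟨C, hC⟩ := hu.exists_forall_le (isCompact_closedBall 0 R) hR
  obtain ⟨t, ht, hfin⟩ := hu.exists_lintegral_sphere_const_sub_ne_top hR hr hrR.le C
  have hrΩ := (closedBall_subset_closedBall hrR.le).trans hR
  have hmem (ω : sphere (0 : E d) 1) := add_smul_unitSphere_mem_closedBall (0 : E d) hr.le ω
  refine erealIntegrable_of_lintegral_const_sub_ne_top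
    (hu.measurable_comp_unitSphere hu.isOpen hr.le hrΩ)
    (.of_forall fun ω => hC _ (closedBall_subset_closedBall hrR.le (hmem ω)))
    (ne_top_of_le_ne_top hfin ?_)
  obtain ⟨ε, -, hε, hε_lim⟩ := exists_seq_strictAnti_tendsto (0 : ℝ)
  have hε_lim' : Tendsto ε atTop (𝓝[>] 0) := tendsto_nhdsWithin_iff.2 ⟨hε_lim, .of_forall hε⟩
  have hlim (ω : sphere (0 : E d) 1) := (hu.tendsto_ofReal_const_sub_regularize hR C
    (x := 0 + r • (ω : E d)) (by rwa [zero_add, norm_smul_unitSphere hr.le])).comp hε_lim'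
  calc ∫⁻ ω, (C - u (0 + r • (ω : E d))).toENNReal ∂(volume : Measure (E d)).toSphere
      = ∫⁻ ω, liminf (fun n => ENNReal.ofReal (C - regularize u R (ε n) (0 + r • (ω : E d)))) atTop
          ∂(volume : Measure (E d)).toSphere :=
        lintegral_congr fun ω => (hlim ω).liminf_eq.symm
    _ ≤ liminf (fun n => ∫⁻ ω, ENNReal.ofReal (C - regularize u R (ε n) (0 + r • (ω : E d)))
          ∂(volume : Measure (E d)).toSphere) atTop :=
        lintegral_liminf_le fun n => by
          have := (hu.contDiff_regularize hR (hε n) (n := 0)).continuous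
          fun_prop
    _ ≤ liminf (fun _ => ∫⁻ ω, (C - u (0 + t • (ω : E d))).toENNReal
          ∂(volume : Measure (E d)).toSphere) (atTop : Filter ℕ) := by
        refine liminf_le_liminf ?_
        filter_upwards [hε_lim.eventually_lt_const (sub_pos.2 hrR)] with n hn
        exact hu.lintegral_sphere_const_sub_regularize_le hR (hε n) ht.1 ht.2.le (by linarith) hC
    _ = _ := liminf_const _

theorem tendsto_sphereIntegral_abs_regularize_sub (hu : NontrivialSubharmonicOn u Ω)
    (hR : closedBall 0 R ⊆ Ω) (hr : 0 < r) (hrR : r < R) :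
    Tendsto (fun ε => sphereIntegral (fun y => |regularize u R ε y - (u y).toReal|) 0 r)
      (𝓝[>] 0) (𝓝 0) := by
  obtain ⟨C, hC⟩ := hu.exists_forall_le (isCompact_closedBall 0 R) hR
  have hint := hu.erealIntegrable_sphere hR hr hrR
  have hnorm (ω : sphere (0 : E d) 1) : ‖(0 : E d) + r • (ω : E d)‖ = r := by
    rw [zero_add, norm_smul_unitSphere hr.le]
  suffices Tendsto (fun ε => sphereIntegral (fun y => |regularize u R ε y - (u y).toReal|) 0 r)
      (𝓝[>] 0) (𝓝 (∫ _, 0 ∂(volume : Measure (E d)).toSphere)) by simpa only [integral_zero]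
  refine tendsto_integral_filter_of_dominated_convergence
    (fun ω => C - (u (0 + r • (ω : E d))).toReal) ?_ ?_
    ((integrable_const C).sub hint.integrable) ?_
  · filter_upwards [self_mem_nhdsWithin] with ε hε
    have := (hu.contDiff_regularize hR hε (n := 0)).continuous
    exact (((by fun_prop : Continuous fun ω : sphere (0 : E d) 1 =>
      regularize u R ε (0 + r • (ω : E d))).aestronglyMeasurable).sub
        hint.integrable.aestronglyMeasurable).norm
  · filter_upwards [Ioo_mem_nhdsGT (sub_pos.2 hrR)] with ε hε
    filter_upwards [hint.ae_ne_bot] with ω hω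
    have hlower := hu.toReal_le_regularize hR hε.1 (by rw [hnorm]; linarith [hε.2]) hω
    have hupper := hu.regularize_le_of_mem_closedBall hR hε.1 (by linarith [hε.2]) hC
      (add_smul_unitSphere_mem_closedBall 0 hr.le ω)
    rw [Real.norm_eq_abs, abs_abs, abs_of_nonneg (sub_nonneg.2 hlower)]
    linarith
  · filter_upwards [hint.ae_ne_bot] with ω hω
    simpa using ((hu.tendsto_regularize hR (by rwa [hnorm]) hω).sub_const
      (u (0 + r • (ω : E d))).toReal).abs

end NontrivialSubharmonicOn

end Regularize

section PositiveDistribution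

open TopologicalSpace
open scoped Distributions CompactlySupported Manifold

variable {V : Type*} [NormedAddCommGroup V] [NormedSpace ℝ V]

section Restriction

variable {Ω : Opens V}

/-- The restriction of test functions to `Ω`, as continuous functions with compact support. -/
def restrictTestFunction (Ω : Opens V) : 𝓓(Ω, ℝ) →ₗ[ℝ] C_c(Ω, ℝ) where
  toFun φ :=
    { toFun := fun x => φ x
      continuous_toFun := φ.continuous.comp continuous_subtype_val
      hasCompactSupport' := by
        have hK : IsCompact ((↑) ⁻¹' tsupport φ : Set Ω) :=
          Ω.isOpenEmbedding'.isInducing.isCompact_preimage' φ.hasCompactSupport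
            (φ.tsupport_subset.trans_eq Subtype.range_coe.symm)
        exact .intro hK fun x hx => image_eq_zero_of_notMem_tsupport hx }
  map_add' _ _ := rfl
  map_smul' _ _ := rfl

theorem testFunction_eq_zero_of_notMem (φ : 𝓓(Ω, ℝ)) {x : V} (hx : x ∉ Ω) : φ x = 0 :=
  image_eq_zero_of_notMem_tsupport fun h => hx (φ.tsupport_subset h)

theorem restrictTestFunction_nonneg_iff {φ : 𝓓(Ω, ℝ)} :
    0 ≤ restrictTestFunction Ω φ ↔ ∀ x, 0 ≤ φ x := by
  refine ⟨fun h x => ?_, fun h x => h x⟩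
  by_cases hx : x ∈ Ω
  · exact h ⟨x, hx⟩
  · exact (testFunction_eq_zero_of_notMem φ hx).ge

theorem restrictTestFunction_injective : Function.Injective (restrictTestFunction Ω) := by
  refine fun φ ψ h => TestFunction.ext fun x => ?_
  by_cases hx : x ∈ Ω
  · exact DFunLike.congr_fun h ⟨x, hx⟩
  · rw [testFunction_eq_zero_of_notMem φ hx, testFunction_eq_zero_of_notMem ψ hx]

end Restriction

variable [FiniteDimensional ℝ V] {Ω : Opens V}

theorem exists_testFunction_eq_one {K : Set V} (hK : IsCompact K) (hKΩ : K ⊆ Ω) :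
    ∃ φ : 𝓓(Ω, ℝ), (∀ x, 0 ≤ φ x) ∧ ∀ x ∈ K, φ x = 1 := by
  obtain ⟨W, hW, hKW, hWΩ, hWc⟩ := exists_open_between_and_isCompact_closure hK Ω.isOpen hKΩ
  obtain ⟨f, hf_zero, hf_one, hf_mem⟩ := exists_contMDiffMap_zero_one_of_isClosed (n := ⊤) 𝓘(ℝ, V)
    hW.isClosed_compl hK.isClosed (disjoint_compl_left_iff_subset.2 hKW)
  have hsupp : tsupport f ⊆ closure W :=
    closure_mono fun x hx => by_contra fun hxW => hx (hf_zero hxW)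
  exact ⟨⟨f, f.contMDiff.contDiff, hWc.of_isClosed_subset (isClosed_tsupport _) hsupp,
    hsupp.trans hWΩ⟩, fun x => (hf_mem x).1, fun x hx => hf_one hx⟩

theorem exists_restrictTestFunction_add_nonneg (f : C_c(Ω, ℝ)) :
    ∃ φ : 𝓓(Ω, ℝ), 0 ≤ restrictTestFunction Ω φ + f := by
  have hf := f.hasCompactSupport.isCompact
  obtain ⟨φ, hφ_nonneg, hφ_one⟩ := exists_testFunction_eq_one (Ω := Ω)
    (hf.image continuous_subtype_val) (by rintro _ ⟨z, -, rfl⟩; exact z.2)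
  obtain ⟨B, hB⟩ := hf.exists_bound_of_continuousOn f.continuous.continuousOn
  refine ⟨|B| • φ, fun x => ?_⟩
  suffices 0 ≤ |B| * φ x + f x from this
  by_cases hx : x ∈ tsupport f
  · rw [hφ_one x ⟨x, hx, rfl⟩]
    have hBx : |f x| ≤ B := hB x hx
    linarith [neg_abs_le (f x), le_abs_self B]
  · rw [image_eq_zero_of_notMem_tsupport hx, add_zero]
    exact mul_nonneg (abs_nonneg _) (hφ_nonneg x)

theorem exists_positiveLinearMap_restrictTestFunction_eq (L : 𝓓(Ω, ℝ) →ₗ[ℝ] ℝ)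
    (hL : ∀ φ : 𝓓(Ω, ℝ), (∀ x, 0 ≤ φ x) → 0 ≤ L φ) :
    ∃ Λ : C_c(Ω, ℝ) →ₚ[ℝ] ℝ, ∀ φ, Λ (restrictTestFunction Ω φ) = L φ := by
  let e := LinearEquiv.ofInjective (restrictTestFunction Ω) restrictTestFunction_injective
  let nonnegCone : PointedCone ℝ C_c(Ω, ℝ) :=
    { carrier := {f | 0 ≤ f}
      add_mem' := fun hf hg x => add_nonneg (hf x) (hg x)
      zero_mem' := le_refl (0 : C_c(Ω, ℝ))
      smul_mem' := fun a f hf x => mul_nonneg a.2 (hf x) }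
  obtain ⟨Λ, hΛL, hΛ⟩ := riesz_extension nonnegCone
    ⟨LinearMap.range (restrictTestFunction Ω), L ∘ₗ e.symm⟩
    (by
      rintro ⟨_, φ, rfl⟩ hφ
      refine (hL φ (restrictTestFunction_nonneg_iff.1 hφ)).trans_eq ?_
      exact congrArg L (e.symm_apply_apply φ).symm)
    (fun f => (exists_restrictTestFunction_add_nonneg f).imp' e fun _ => id)
  exact ⟨.mk₀ Λ hΛ, fun φ => (hΛL (e φ)).trans (congrArg L (e.symm_apply_apply φ))⟩

theorem exists_measure_eq_integral_of_nonneg [MeasurableSpace V] [BorelSpace V]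
    (L : 𝓓(Ω, ℝ) →ₗ[ℝ] ℝ) (hL : ∀ φ : 𝓓(Ω, ℝ), (∀ x, 0 ≤ φ x) → 0 ≤ L φ) :
    ∃ μ : Measure V, μ (Ω : Set V)ᶜ = 0 ∧ (∀ K, IsCompact K → K ⊆ Ω → μ K < ⊤) ∧
      ∀ φ, L φ = ∫ x, φ x ∂μ := by
  have : LocallyCompactSpace Ω := Ω.isOpen.locallyCompactSpace
  obtain ⟨Λ, hΛ⟩ := exists_positiveLinearMap_restrictTestFunction_eq L hL
  have hemb : MeasurableEmbedding ((↑) : Ω → V) := Ω.isOpenEmbedding'.measurableEmbedding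
  refine ⟨(RealRMK.rieszMeasure Λ).map (↑), ?_, fun K hK hKΩ => ?_, fun φ => ?_⟩
  · have hempty : ((↑) ⁻¹' (Ω : Set V)ᶜ : Set Ω) = ∅ :=
      eq_empty_of_forall_notMem fun x hx => hx x.2
    rw [hemb.map_apply, hempty, measure_empty]
  · rw [hemb.map_apply]
    exact (Ω.isOpenEmbedding'.isInducing.isCompact_preimage' hK
      (hKΩ.trans_eq Subtype.range_coe.symm)).measure_lt_top
  · rw [hemb.integral_map, ← hΛ, ← RealRMK.integral_rieszMeasure]
    rfl

end PositiveDistribution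

section RieszMeasure

open TopologicalSpace
open scoped Distributions

theorem tsupport_laplacian_subset {V : Type*} [NormedAddCommGroup V] [InnerProductSpace ℝ V]
    [FiniteDimensional ℝ V] (f : V → ℝ) : tsupport (Δ f) ⊆ tsupport f := by
  refine closure_minimal (fun x hx => ?_) (isClosed_tsupport f)
  contrapose! hx
  have hzero : f =ᶠ[𝓝 x] fun _ => 0 := notMem_tsupport_iff_eventuallyEq.1 hx
  simp [(InnerProductSpace.laplacian_congr_nhds hzero).self_of_nhds]

theorem closedBall_zero_subset_eball_zero {V : Type*} [SeminormedAddCommGroup V] {ρ : ℝ≥0∞}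
    {R : ℝ} (hR : ENNReal.ofReal R < ρ) : closedBall (0 : V) R ⊆ eball 0 ρ := fun x hx => by
  rw [mem_eball, edist_dist]
  exact (ENNReal.ofReal_le_ofReal hx).trans_lt hR

theorem exists_subset_ball_closedBall_subset_eball {V : Type*} [SeminormedAddCommGroup V]
    {ρ : ℝ≥0∞} {K : Set V} (hK : IsCompact K) (hKρ : K ⊆ eball 0 ρ) :
    ∃ R, K ⊆ ball 0 R ∧ closedBall (0 : V) R ⊆ eball 0 ρ := by
  obtain rfl | hne := K.eq_empty_or_nonempty
  · exact ⟨-1, empty_subset _, by simp⟩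
  obtain ⟨a, ha, hmax⟩ := hK.exists_isMaxOn hne continuous_norm.continuousOn
  have haρ := hKρ ha
  rw [mem_eball, edist_dist, dist_zero_right] at haρ
  obtain ⟨R, -, haR, hRρ⟩ := ENNReal.lt_iff_exists_real_btwn.1 haρ
  refine ⟨R, fun x hx => mem_ball_zero_iff.2 ((hmax hx).trans_lt ?_),
    closedBall_zero_subset_eball_zero hRρ⟩
  exact (ENNReal.ofReal_lt_ofReal_iff'.1 haR).1

variable {d : ℕ} {u : E d → EReal} {Ω : Set (E d)} {R : ℝ} {φ : E d → ℝ}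

namespace NontrivialSubharmonicOn

variable [NeZero d]

theorem integrable_toReal_mul (hu : NontrivialSubharmonicOn u Ω) (hφ : Continuous φ)
    (hsupp : HasCompactSupport φ) (hφΩ : tsupport φ ⊆ Ω) :
    Integrable fun x => (u x).toReal * φ x := by
  rw [← integrableOn_iff_integrable_of_support_subset (s := tsupport φ)]
  · exact (hu.integrableOn_isCompact hsupp hφΩ).mul_continuousOn hφ.continuousOn hsupp
  · exact (Function.support_mul_subset_right _ _).trans (subset_tsupport φ)

theorem tendsto_integral_regularize_mul (hu : NontrivialSubharmonicOn u Ω)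
    (hR : closedBall 0 R ⊆ Ω) (hφ : Continuous φ) (hφR : tsupport φ ⊆ ball 0 R) :
    Tendsto (fun ε => ∫ x, regularize u R ε x * φ x) (𝓝[>] 0)
      (𝓝 (∫ x, (u x).toReal * φ x)) := by
  obtain ⟨r, hrR, hφr⟩ := exists_lt_subset_ball (isClosed_tsupport φ) hφR
  have hsupp : HasCompactSupport φ := (isCompact_closedBall 0 R).of_isClosed_subset
    (isClosed_tsupport φ) (hφR.trans ball_subset_closedBall)
  obtain ⟨C, hC⟩ := hu.exists_forall_le (isCompact_closedBall 0 R) hR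
  have hint := hu.integrable_toReal_mul hφ hsupp ((hφR.trans ball_subset_closedBall).trans hR)
  refine tendsto_integral_filter_of_dominated_convergence
    (fun x => |C * φ x| + |(u x).toReal * φ x|) ?_ ?_
    (((hφ.integrable_of_hasCompactSupport hsupp).const_mul C).abs.add hint.abs) ?_
  · filter_upwards [self_mem_nhdsWithin] with ε hε
    exact ((hu.contDiff_regularize hR hε (n := 0)).continuous.mul hφ).aestronglyMeasurable
  · filter_upwards [Ioo_mem_nhdsGT (sub_pos.2 hrR)] with ε hε
    filter_upwards [hu.ae_ne_bot] with x hx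
    by_cases hxφ : x ∈ tsupport φ
    · have hxr := ball_subset_closedBall (hφr hxφ)
      have hxR : ‖x‖ + ε ≤ R := by linarith [mem_closedBall_zero_iff.1 hxr, hε.2]
      have hxΩ := hR (closedBall_subset_closedBall hrR.le hxr)
      have hbound := abs_le_max_abs_abs (hu.toReal_le_regularize hR hε.1 hxR (hx hxΩ))
        (hu.regularize_le_of_mem_closedBall hR hε.1 (by linarith [hε.2]) hC hxr)
      rw [Real.norm_eq_abs, abs_mul, abs_mul, abs_mul, ← add_mul, add_comm]
      gcongr
      exact hbound.trans (max_le_add_of_nonneg (abs_nonneg _) (abs_nonneg _))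
    · simp [image_eq_zero_of_notMem_tsupport hxφ]
  · filter_upwards [hu.ae_ne_bot] with x hx
    by_cases hxφ : x ∈ tsupport φ
    · exact (hu.tendsto_regularize hR (mem_ball_zero_iff.1 (hφR hxφ))
        (hx (hR (ball_subset_closedBall (hφR hxφ))))).mul_const _
    · simp [image_eq_zero_of_notMem_tsupport hxφ]

theorem integral_toReal_mul_laplacian_nonneg (hu : NontrivialSubharmonicOn u Ω)
    (hR : closedBall 0 R ⊆ Ω) (hφ : ContDiff ℝ 2 φ) (hφR : tsupport φ ⊆ ball 0 R)
    (hφ_nonneg : ∀ x, 0 ≤ φ x) : 0 ≤ ∫ x, (u x).toReal * (Δ φ) x := by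
  obtain ⟨r, hrR, hφr⟩ := exists_lt_subset_ball (isClosed_tsupport φ) hφR
  have hsupp : HasCompactSupport φ := (isCompact_closedBall 0 R).of_isClosed_subset
    (isClosed_tsupport φ) (hφR.trans ball_subset_closedBall)
  refine ge_of_tendsto (hu.tendsto_integral_regularize_mul hR (continuous_laplacian hφ)
    ((tsupport_laplacian_subset φ).trans hφR)) ?_
  filter_upwards [Ioo_mem_nhdsGT (sub_pos.2 hrR)] with ε hε
  rw [integral_mul_laplacian_comm volume (hu.contDiff_regularize hR hε.1 (n := 2)) hφ hsupp]
  refine integral_nonneg fun x => ?_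
  by_cases hxφ : x ∈ tsupport φ
  · exact mul_nonneg (hφ_nonneg x) (hu.laplacian_regularize_nonneg hR hε.1
      (by linarith [mem_ball_zero_iff.1 (hφr hxφ), hε.2]))
  · simp [image_eq_zero_of_notMem_tsupport hxφ]

variable {ρ : ℝ≥0∞}

theorem exists_isRieszMeasure (hu : NontrivialSubharmonicOn u (eball 0 ρ)) :
    ∃ μ, IsRieszMeasure (eball 0 ρ) u μ := by
  let Ω : Opens (E d) := ⟨eball 0 ρ, hu.isOpen⟩
  let c := sphereArea d * dHat d
  have hc : 0 < c := mul_pos sphereArea_pos (one_pos.trans_le (le_max_left _ _))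
  have hφ_contDiff (φ : 𝓓(Ω, ℝ)) : ContDiff ℝ 2 φ :=
    φ.contDiff.of_le (WithTop.coe_le_coe.2 le_top)
  have hint (φ : 𝓓(Ω, ℝ)) : Integrable fun x => (u x).toReal * (Δ ⇑φ) x :=
    hu.integrable_toReal_mul (continuous_laplacian (hφ_contDiff φ))
      (φ.hasCompactSupport.of_isClosed_subset (isClosed_tsupport _) (tsupport_laplacian_subset φ))
      ((tsupport_laplacian_subset φ).trans φ.tsupport_subset)
  let L : 𝓓(Ω, ℝ) →ₗ[ℝ] ℝ :=
    { toFun := fun φ => c⁻¹ * ∫ x, (u x).toReal * (Δ ⇑φ) x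
      map_add' := fun φ ψ => by
        rw [← mul_add, ← integral_add (hint φ) (hint ψ)]
        simp only [FunLike.coe_add, mul_add,
          (hφ_contDiff φ).contDiffAt.laplacian_add (hφ_contDiff ψ).contDiffAt]
      map_smul' := fun a φ => by
        simp only [FunLike.coe_smul, InnerProductSpace.laplacian_smul a (hφ_contDiff φ).contDiffAt,
          smul_eq_mul, mul_left_comm _ a, integral_const_mul, RingHom.id_apply] }
  have hL (φ : 𝓓(Ω, ℝ)) (hφ : ∀ x, 0 ≤ φ x) : 0 ≤ L φ := by
    obtain ⟨R, hφR, hR⟩ :=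
      exists_subset_ball_closedBall_subset_eball φ.hasCompactSupport φ.tsupport_subset
    exact mul_nonneg (inv_nonneg.2 hc.le) (hu.integral_toReal_mul_laplacian_nonneg hR
      (hφ_contDiff φ) hφR hφ)
  obtain ⟨μ, hμ_compl, hμ_compact, hμ⟩ := exists_measure_eq_integral_of_nonneg L hL
  refine ⟨μ, hμ_compl, hμ_compact, fun φ hφ hφ_supp hφΩ => ?_⟩
  exact (mul_inv_cancel_left₀ hc.ne' _).symm.trans
    (congrArg (c * ·) (hμ ⟨φ, hφ, hφ_supp, hφΩ⟩))

theorem isRieszMeasure_rieszMeasure (hu : NontrivialSubharmonicOn u (eball 0 ρ)) :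
    IsRieszMeasure (eball 0 ρ) u (rieszMeasure (eball 0 ρ) u) := by
  have h := hu.exists_isRieszMeasure
  rw [rieszMeasure, dif_pos h]
  exact h.choose_spec

end NontrivialSubharmonicOn

end RieszMeasure

section ChainRule

variable {V : Type*} [NormedAddCommGroup V] [InnerProductSpace ℝ V]

theorem fderiv_comp_const_sub_apply {f : V → ℝ} (hf : Differentiable ℝ f) (x y v : V) :
    fderiv ℝ (fun z => f (x - z)) y v = -fderiv ℝ f (x - y) v := by
  have hcomp : HasFDerivAt (fun z => f (x - z))
      (fderiv ℝ f (x - y) ∘L (-ContinuousLinearMap.id ℝ V)) y :=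
    (hf (x - y)).hasFDerivAt.comp y ((hasFDerivAt_id y).const_sub x)
  rw [hcomp.fderiv]
  simp

variable [FiniteDimensional ℝ V] {f : V → ℝ}

theorem laplacian_comp_const_sub (hf : ContDiff ℝ 2 f) (x y : V) :
    (Δ fun z => f (x - z)) y = (Δ f) (x - y) := by
  have hshift : ContDiff ℝ 2 fun z => f (x - z) := hf.comp (contDiff_const.sub contDiff_id)
  rw [laplacian_eq_sum_fderiv_fderiv (stdOrthonormalBasis ℝ V) hshift,
    laplacian_eq_sum_fderiv_fderiv (stdOrthonormalBasis ℝ V) hf]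
  simp only [fderiv_comp_const_sub_apply (hf.differentiable (by norm_num)), fderiv_fun_neg,
    neg_apply, neg_neg, fderiv_comp_const_sub_apply (f := fun z => fderiv ℝ f z _)
      ((contDiff_fderiv_apply hf _).differentiable one_ne_zero)]

theorem laplacian_comp {φ φ' : ℝ → ℝ} {c : ℝ} (hφ : ∀ s, HasDerivAt φ (φ' s) s)
    (hφ2 : ContDiff ℝ 2 φ) (hf : ContDiff ℝ 2 f) (x : V) (hφ' : HasDerivAt φ' c (f x)) :
    (Δ fun y => φ (f y)) x = c * ‖∇ f x‖ ^ 2 + φ' (f x) * (Δ f) x := by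
  have hfd (y : V) : HasFDerivAt f (fderiv ℝ f y) y :=
    (hf.differentiable (by norm_num) y).hasFDerivAt
  have hfirst (v : V) : (fun y => fderiv ℝ (fun y => φ (f y)) y v) =
      fun y => φ' (f y) * fderiv ℝ f y v := by
    ext y
    exact DFunLike.congr_fun ((hφ (f y)).comp_hasFDerivAt y (hfd y)).fderiv v
  have hsecond (v : V) : fderiv ℝ (fun y => φ' (f y) * fderiv ℝ f y v) x v =
      c * (fderiv ℝ f x v * fderiv ℝ f x v) +
        φ' (f x) * fderiv ℝ (fun y => fderiv ℝ f y v) x v := by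
    have hfv := ((contDiff_fderiv_apply hf v).differentiable one_ne_zero x).hasFDerivAt
    have hmul := (hφ'.comp_hasFDerivAt x (hfd x)).fun_mul hfv
    simp only [Function.comp_apply] at hmul
    rw [hmul.fderiv]
    simp only [add_apply, smul_apply, smul_eq_mul]
    ring
  let b := stdOrthonormalBasis ℝ V
  have hcomp : ContDiff ℝ 2 fun y => φ (f y) := hφ2.comp hf
  rw [laplacian_eq_sum_fderiv_fderiv b hcomp, laplacian_eq_sum_fderiv_fderiv b hf]
  simp only [hfirst, hsecond]
  rw [Finset.sum_add_distrib, ← Finset.mul_sum, ← Finset.mul_sum,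
    sum_fderiv_mul_fderiv_eq_inner_gradient, real_inner_self_eq_norm_sq]

end ChainRule

section SmoothPosPart

/-- A smooth convex approximation, within `δ`, of the positive part of a real number. -/
def smoothPosPart (δ s : ℝ) : ℝ := (s + √(s ^ 2 + δ ^ 2)) / 2

variable {δ : ℝ}

theorem abs_smoothPosPart_sub_le (hδ : 0 ≤ δ) (s : ℝ) : |smoothPosPart δ s - max 0 s| ≤ δ := by
  have hlower : |s| ≤ √(s ^ 2 + δ ^ 2) := Real.abs_le_sqrt (by nlinarith)
  have hupper : √(s ^ 2 + δ ^ 2) ≤ |s| + δ := by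
    rw [Real.sqrt_le_left (by positivity)]
    nlinarith [abs_nonneg s, sq_abs s]
  rw [smoothPosPart, abs_le]
  rcases abs_cases s with ⟨h, hs⟩ | ⟨h, hs⟩
  · rw [max_eq_right hs]
    constructor <;> linarith
  · rw [max_eq_left hs.le]
    constructor <;> linarith

theorem contDiff_smoothPosPart (hδ : 0 < δ) {n : ℕ∞} : ContDiff ℝ n (smoothPosPart δ) :=
  (contDiff_id.add (ContDiff.sqrt (by fun_prop) fun _ => by positivity)).div_const 2

theorem hasDerivAt_sqrt_sq_add_sq (hδ : 0 < δ) (s : ℝ) :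
    HasDerivAt (fun s => √(s ^ 2 + δ ^ 2)) (s / √(s ^ 2 + δ ^ 2)) s := by
  have hsq : HasDerivAt (fun s : ℝ => s ^ 2 + δ ^ 2) (2 * s) s := by
    simpa using (hasDerivAt_pow 2 s).add_const (δ ^ 2)
  exact (hsq.sqrt (by positivity)).congr_deriv (mul_div_mul_left _ _ two_ne_zero)

theorem hasDerivAt_smoothPosPart (hδ : 0 < δ) (s : ℝ) :
    HasDerivAt (smoothPosPart δ) ((1 + s / √(s ^ 2 + δ ^ 2)) / 2) s :=
  ((hasDerivAt_id s).add (hasDerivAt_sqrt_sq_add_sq hδ s)).div_const 2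

theorem hasDerivAt_deriv_smoothPosPart (hδ : 0 < δ) (s : ℝ) :
    HasDerivAt (fun s => (1 + s / √(s ^ 2 + δ ^ 2)) / 2) (δ ^ 2 / √(s ^ 2 + δ ^ 2) ^ 3 / 2) s := by
  have hpos : 0 < √(s ^ 2 + δ ^ 2) := Real.sqrt_pos.2 (by positivity)
  have hdiv := (hasDerivAt_id s).div (hasDerivAt_sqrt_sq_add_sq hδ s) hpos.ne'
  refine ((hdiv.const_add 1).div_const 2).congr_deriv ?_
  have hsq : √(s ^ 2 + δ ^ 2) ^ 2 = s ^ 2 + δ ^ 2 := Real.sq_sqrt (by positivity)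
  simp only [id]
  field_simp
  rw [hsq]
  ring

theorem neg_le_laplacian_smoothPosPart_comp {V : Type*} [NormedAddCommGroup V]
    [InnerProductSpace ℝ V] [FiniteDimensional ℝ V] {f : V → ℝ} {x : V} {m : ℝ} (hδ : 0 < δ)
    (hf : ContDiff ℝ 2 f) (hm : 0 ≤ m) (hΔ : -m ≤ (Δ f) x) :
    -m ≤ (Δ fun y => smoothPosPart δ (f y)) x := by
  rw [laplacian_comp (hasDerivAt_smoothPosPart hδ) (contDiff_smoothPosPart hδ (n := 2)) hf x
    (hasDerivAt_deriv_smoothPosPart hδ (f x))]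
  have hgrad : 0 ≤ δ ^ 2 / √(f x ^ 2 + δ ^ 2) ^ 3 / 2 * ‖∇ f x‖ ^ 2 := by positivity
  have hslope : |f x / √(f x ^ 2 + δ ^ 2)| ≤ 1 := by
    rw [abs_div, abs_of_nonneg (Real.sqrt_nonneg _)]
    exact div_le_one_of_le₀ (Real.abs_le_sqrt (by nlinarith)) (Real.sqrt_nonneg _)
  obtain ⟨hslope₀, hslope₁⟩ := abs_le.1 hslope
  nlinarith

end SmoothPosPart

section WeightedAverage

variable {w q : ℝ → ℝ} {a b c : ℝ}

theorem intervalIntegrable_mul_of_monotoneOn (hab : a ≤ b) (hw : ContinuousOn w (Icc a b))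
    (hq : MonotoneOn q (Icc a b)) : IntervalIntegrable (fun t => w t * q t) volume a b := by
  rw [← uIcc_of_le hab] at hw hq
  exact hq.intervalIntegrable.continuousOn_mul hw

theorem integral_mul_le_integral_mul_const_of_monotoneOn (hab : a ≤ b)
    (hw : ContinuousOn w (Icc a b)) (hw0 : ∀ t ∈ Icc a b, 0 ≤ w t) (hq : MonotoneOn q (Icc a b)) :
    ∫ t in a..b, w t * q t ≤ (∫ t in a..b, w t) * q b := by
  rw [← intervalIntegral.integral_mul_const]
  refine intervalIntegral.integral_mono_on hab (intervalIntegrable_mul_of_monotoneOn hab hw hq)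
    ((hw.intervalIntegrable_of_Icc hab).mul_const _) fun t ht => ?_
  exact mul_le_mul_of_nonneg_left (hq ht ⟨hab, le_rfl⟩ ht.2) (hw0 t ht)

theorem integral_mul_const_le_integral_mul_of_monotoneOn (hab : a ≤ b)
    (hw : ContinuousOn w (Icc a b)) (hw0 : ∀ t ∈ Icc a b, 0 ≤ w t) (hq : MonotoneOn q (Icc a b)) :
    (∫ t in a..b, w t) * q a ≤ ∫ t in a..b, w t * q t := by
  rw [← intervalIntegral.integral_mul_const]
  refine intervalIntegral.integral_mono_on hab ((hw.intervalIntegrable_of_Icc hab).mul_const _)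
    (intervalIntegrable_mul_of_monotoneOn hab hw hq) fun t ht => ?_
  exact mul_le_mul_of_nonneg_left (hq ⟨le_rfl, hab⟩ ht ht.1) (hw0 t ht)

theorem integral_mul_integral_le_of_monotoneOn (hab : a ≤ b) (hbc : b ≤ c)
    (hw : ContinuousOn w (Icc a c)) (hw0 : ∀ t ∈ Icc a c, 0 ≤ w t) (hq : MonotoneOn q (Icc a c)) :
    (∫ t in b..c, w t) * ∫ t in a..b, w t * q t ≤ (∫ t in a..b, w t) * ∫ t in b..c, w t * q t := by
  have hleft : Icc a b ⊆ Icc a c := Icc_subset_Icc_right hbc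
  have hright : Icc b c ⊆ Icc a c := Icc_subset_Icc_left hab
  calc (∫ t in b..c, w t) * ∫ t in a..b, w t * q t
      ≤ (∫ t in b..c, w t) * ((∫ t in a..b, w t) * q b) :=
        mul_le_mul_of_nonneg_left
          (integral_mul_le_integral_mul_const_of_monotoneOn hab (hw.mono hleft)
            (fun t ht => hw0 t (hleft ht)) (hq.mono hleft))
          (intervalIntegral.integral_nonneg hbc fun t ht => hw0 t (hright ht))
    _ = (∫ t in a..b, w t) * ((∫ t in b..c, w t) * q b) := by ring
    _ ≤ (∫ t in a..b, w t) * ∫ t in b..c, w t * q t :=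
        mul_le_mul_of_nonneg_left
          (integral_mul_const_le_integral_mul_of_monotoneOn hbc (hw.mono hright)
            (fun t ht => hw0 t (hright ht)) (hq.mono hright))
          (intervalIntegral.integral_nonneg hab fun t ht => hw0 t (hleft ht))

theorem continuousOn_inv_pow (n : ℕ) (ha : 0 < a) :
    ContinuousOn (fun t : ℝ => (t ^ n)⁻¹) (Icc a b) :=
  (continuous_pow _).continuousOn.inv₀ fun _ ht => pow_ne_zero _ (ha.trans_le ht.1).ne'

theorem inv_pow_nonneg_of_mem_Icc (n : ℕ) (ha : 0 < a) : ∀ t ∈ Icc a b, 0 ≤ (t ^ n)⁻¹ :=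
  fun _ ht => inv_nonneg.2 (pow_nonneg (ha.trans_le ht.1).le _)

end WeightedAverage

section RadialIncrement

variable {V : Type*} [NormedAddCommGroup V] [InnerProductSpace ℝ V] [FiniteDimensional ℝ V]
  [MeasurableSpace V] [BorelSpace V] {f g : V → ℝ} {a b c : ℝ}

theorem monotoneOn_setIntegral_ball (hg : Continuous g) (hg0 : ∀ x ∈ ball 0 c, 0 ≤ g x) :
    MonotoneOn (fun t => ∫ x in ball 0 t, g x) (Iic c) := by
  intro s _ t ht hst
  refine setIntegral_mono_set (integrableOn_ball_of_continuous hg 0 t) ?_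
    (ball_subset_ball hst).eventuallyLE
  filter_upwards [ae_restrict_mem measurableSet_ball] with x hx
  exact hg0 x (ball_subset_ball ht hx)

/-- The increment from `a` to `b` of `r ↦ ∫ ω, f (r • ω) + ∫ t in 1..r, t ^ (1 - dim V) * G t`,
the sphere integral of `f` corrected by the flux `G` of a source. -/
def radialIncrement (f : V → ℝ) (G : ℝ → ℝ) (a b : ℝ) : ℝ :=
  sphereIntegral f 0 b - sphereIntegral f 0 a +
    ∫ t in a..b, (t ^ (finrank ℝ V - 1))⁻¹ * G t

variable [Nontrivial V]

theorem radialIncrement_eq_integral (hf : ContDiff ℝ 2 f) (hg : Continuous g) (hg0 : ∀ x, 0 ≤ g x)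
    (ha : 0 < a) (hab : a ≤ b) :
    radialIncrement f (fun t => ∫ x in ball 0 t, g x) a b =
      ∫ t in a..b, (t ^ (finrank ℝ V - 1))⁻¹ * ∫ x in ball 0 t, ((Δ f) x + g x) := by
  have hflux := continuous_integral_fderiv_unitSphere (hf.of_le one_le_two)
  rw [radialIncrement, ← intervalIntegral.integral_eq_sub_of_hasDerivAt
      (fun t _ => hasDerivAt_sphereIntegral_zero (hf.of_le one_le_two) t)
      (hflux.intervalIntegrable a b),
    ← intervalIntegral.integral_add (hflux.intervalIntegrable a b)
      (intervalIntegrable_mul_of_monotoneOn hab (continuousOn_inv_pow _ ha)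
        ((monotoneOn_setIntegral_ball hg fun x _ => hg0 x).mono Icc_subset_Iic_self))]
  refine intervalIntegral.integral_congr fun t ht => ?_
  rw [uIcc_of_le hab] at ht
  have ht0 : 0 < t := ha.trans_le ht.1
  simp only [mul_add, ← pow_mul_integral_fderiv_unitSphere hf ht0,
    integral_add (integrableOn_ball_of_continuous (continuous_laplacian hf) 0 t)
      (integrableOn_ball_of_continuous hg 0 t)]
  rw [inv_mul_cancel_left₀ (by positivity)]

theorem radialIncrement_nonneg (hf : ContDiff ℝ 2 f) (hg : Continuous g) (hg0 : ∀ x, 0 ≤ g x)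
    (ha : 0 < a) (hab : a ≤ b) (hΔ : ∀ x ∈ ball 0 b, -g x ≤ (Δ f) x) :
    0 ≤ radialIncrement f (fun t => ∫ x in ball 0 t, g x) a b := by
  rw [radialIncrement_eq_integral hf hg hg0 ha hab]
  refine intervalIntegral.integral_nonneg hab fun t ht =>
    mul_nonneg (inv_pow_nonneg_of_mem_Icc _ ha t ht) ?_
  refine setIntegral_nonneg measurableSet_ball fun x hx => ?_
  linarith [hΔ x (ball_subset_ball ht.2 hx)]

theorem integral_mul_radialIncrement_le (hf : ContDiff ℝ 2 f) (hg : Continuous g)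
    (hg0 : ∀ x, 0 ≤ g x) (ha : 0 < a) (hab : a ≤ b) (hbc : b ≤ c)
    (hΔ : ∀ x ∈ ball 0 c, -g x ≤ (Δ f) x) :
    (∫ t in b..c, (t ^ (finrank ℝ V - 1))⁻¹) *
        radialIncrement f (fun t => ∫ x in ball 0 t, g x) a b ≤
      (∫ t in a..b, (t ^ (finrank ℝ V - 1))⁻¹) *
        radialIncrement f (fun t => ∫ x in ball 0 t, g x) b c := by
  rw [radialIncrement_eq_integral hf hg hg0 ha hab,
    radialIncrement_eq_integral hf hg hg0 (ha.trans_le hab) hbc]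
  refine integral_mul_integral_le_of_monotoneOn hab hbc (continuousOn_inv_pow _ ha)
    (inv_pow_nonneg_of_mem_Icc _ ha) ?_
  refine (monotoneOn_setIntegral_ball ((continuous_laplacian hf).add hg) fun x hx => ?_).mono
    Icc_subset_Iic_self
  exact neg_le_iff_add_nonneg.1 (hΔ x hx)

end RadialIncrement

section MollifyMeasure

variable {V : Type*} [NormedAddCommGroup V] [InnerProductSpace ℝ V] [FiniteDimensional ℝ V]
  [MeasurableSpace V] [BorelSpace V] {ε t : ℝ} {y : V}

theorem integral_ball_mollifier_sub_nonneg (ε t : ℝ) (y : V) :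
    0 ≤ ∫ x in ball 0 t, mollifier ε (x - y) :=
  integral_nonneg fun _ => mollifier_nonneg ε _

theorem integral_ball_mollifier_sub_le_one (hε : 0 < ε) (t : ℝ) (y : V) :
    ∫ x in ball 0 t, mollifier ε (x - y) ≤ 1 :=
  calc ∫ x in ball 0 t, mollifier ε (x - y) ≤ ∫ x, mollifier ε (x - y) :=
        setIntegral_le_integral ((integrable_mollifier hε).comp_sub_right y)
          (.of_forall fun _ => mollifier_nonneg ε _)
    _ = 1 := by rw [integral_sub_right_eq_self (mollifier ε : V → ℝ) y, integral_mollifier hε]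

theorem integral_ball_mollifier_sub_eq_one (hε : 0 < ε) (hy : ‖y‖ + ε ≤ t) :
    ∫ x in ball 0 t, mollifier ε (x - y) = 1 := by
  rw [setIntegral_eq_integral_of_forall_compl_eq_zero,
    integral_sub_right_eq_self (mollifier ε : V → ℝ) y, integral_mollifier hε]
  intro x hx
  rw [mem_ball_zero_iff, not_lt] at hx
  exact mollifier_eq_zero hε (by linarith [norm_sub_norm_le x y])

theorem integral_ball_mollifier_sub_eq_zero (hε : 0 < ε) (hy : t + ε ≤ ‖y‖) :
    ∫ x in ball 0 t, mollifier ε (x - y) = 0 := by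
  refine setIntegral_eq_zero_of_forall_eq_zero fun x hx => mollifier_eq_zero hε ?_
  rw [mem_ball_zero_iff] at hx
  linarith [norm_sub_norm_le y x, norm_sub_rev x y]

theorem stronglyMeasurable_integral_ball_mollifier_sub (ε t : ℝ) :
    StronglyMeasurable fun y : V => ∫ x in ball 0 t, mollifier ε (x - y) := by
  have hcont : Continuous (Function.uncurry fun y x : V => mollifier ε (x - y)) :=
    continuous_mollifier.comp (continuous_snd.sub continuous_fst)
  exact hcont.stronglyMeasurable.integral_prod_right

/-- The density of the convolution of the measure `τ` with the mollifier at scale `ε`. -/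
def mollifyMeasure (ε : ℝ) (τ : Measure V) (x : V) : ℝ := ∫ y, mollifier ε (x - y) ∂τ

theorem mollifyMeasure_nonneg (ε : ℝ) (τ : Measure V) (x : V) : 0 ≤ mollifyMeasure ε τ x :=
  integral_nonneg fun _ => mollifier_nonneg ε _

theorem mollifyMeasure_restrict (τ : Measure V) (hε : 0 < ε) {x : V} {R : ℝ} (hx : ‖x‖ + ε ≤ R) :
    mollifyMeasure ε (τ.restrict (closedBall 0 R)) x = mollifyMeasure ε τ x := by
  refine setIntegral_eq_integral_of_forall_compl_eq_zero fun y hy => mollifier_eq_zero hε ?_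
  rw [mem_closedBall_zero_iff, not_le] at hy
  linarith [norm_sub_norm_le y x, norm_sub_rev x y]

variable (τ : Measure V) [IsFiniteMeasure τ]

theorem integrable_mollifier_sub (hε : 0 < ε) (x : V) :
    Integrable (fun y => mollifier ε (x - y)) τ := by
  obtain ⟨B, hB⟩ := exists_mollifier_le (V := V) hε
  have hcont : Continuous fun y : V => mollifier ε (x - y) :=
    continuous_mollifier.comp (continuous_const.sub continuous_id)
  refine .of_bound hcont.aestronglyMeasurable B (.of_forall fun y => ?_)
  rw [Real.norm_of_nonneg (mollifier_nonneg ε _)]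
  exact hB _

theorem continuous_mollifyMeasure (hε : 0 < ε) : Continuous (mollifyMeasure ε τ) := by
  obtain ⟨B, hB⟩ := exists_mollifier_le (V := V) hε
  refine continuous_of_dominated (fun x => (integrable_mollifier_sub τ hε x).1)
    (fun x => .of_forall fun y => ?_) (integrable_const B)
    (.of_forall fun y => continuous_mollifier.comp (continuous_id.sub continuous_const))
  rw [Real.norm_of_nonneg (mollifier_nonneg ε _)]
  exact hB _

theorem integral_ball_mollifyMeasure (hε : 0 < ε) (t : ℝ) :
    ∫ x in ball 0 t, mollifyMeasure ε τ x = ∫ y, (∫ x in ball 0 t, mollifier ε (x - y)) ∂τ := by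
  obtain ⟨B, hB⟩ := exists_mollifier_le (V := V) hε
  have : IsFiniteMeasure ((volume : Measure V).restrict (ball 0 t)) :=
    ⟨by rw [Measure.restrict_apply_univ]; exact measure_ball_lt_top⟩
  have hcont : Continuous (Function.uncurry fun x y : V => mollifier ε (x - y)) :=
    continuous_mollifier.comp (continuous_fst.sub continuous_snd)
  refine integral_integral_swap
    (.of_bound hcont.aestronglyMeasurable B (.of_forall fun p => ?_))
  rw [Function.uncurry, Real.norm_of_nonneg (mollifier_nonneg ε _)]
  exact hB _

theorem integral_ball_mollifyMeasure_le (hε : 0 < ε) (t : ℝ) :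
    ∫ x in ball 0 t, mollifyMeasure ε τ x ≤ τ.real univ := by
  have hle (y : V) := integral_ball_mollifier_sub_le_one hε t y
  rw [integral_ball_mollifyMeasure τ hε, ← mul_one (τ.real univ), ← smul_eq_mul,
    ← integral_const (1 : ℝ)]
  refine integral_mono (.of_bound
    (stronglyMeasurable_integral_ball_mollifier_sub ε t).aestronglyMeasurable 1
    (.of_forall fun y => ?_)) (integrable_const _) hle
  rw [Real.norm_of_nonneg (integral_ball_mollifier_sub_nonneg ε t y)]
  exact hle y

theorem tendsto_integral_ball_mollifyMeasure (ht : τ {y | ‖y‖ = t} = 0) :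
    Tendsto (fun ε => ∫ x in ball 0 t, mollifyMeasure ε τ x) (𝓝[>] 0)
      (𝓝 (τ.real (closedBall 0 t))) := by
  have hlim : τ.real (closedBall 0 t) = ∫ y, (closedBall (0 : V) t).indicator 1 y ∂τ := by
    rw [integral_indicator_one measurableSet_closedBall]
  have hpos : ∀ᶠ ε : ℝ in 𝓝[>] 0, 0 < ε := self_mem_nhdsWithin
  rw [hlim]
  refine Tendsto.congr' (hpos.mono fun ε hε => (integral_ball_mollifyMeasure τ hε t).symm) ?_
  refine tendsto_integral_filter_of_dominated_convergence (fun _ => 1)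
    (.of_forall fun ε =>
      (stronglyMeasurable_integral_ball_mollifier_sub ε t).aestronglyMeasurable)
    (hpos.mono fun ε hε => .of_forall fun y => ?_) (integrable_const _) ?_
  · rw [Real.norm_of_nonneg (integral_ball_mollifier_sub_nonneg ε t y)]
    exact integral_ball_mollifier_sub_le_one hε t y
  have hne : ∀ᵐ y ∂τ, ‖y‖ ≠ t := by simpa [ae_iff] using ht
  filter_upwards [hne] with y hy
  refine tendsto_const_nhds.congr' ?_
  rcases lt_or_gt_of_ne hy with hlt | hgt
  · filter_upwards [Ioo_mem_nhdsGT (sub_pos.2 hlt)] with ε hε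
    rw [integral_ball_mollifier_sub_eq_one hε.1 (by linarith [hε.2]),
      indicator_of_mem (by simpa using hlt.le), Pi.one_apply]
  · filter_upwards [Ioo_mem_nhdsGT (sub_pos.2 hgt)] with ε hε
    rw [integral_ball_mollifier_sub_eq_zero hε.1 (by linarith [hε.2]),
      indicator_of_notMem (by simpa using hgt)]

theorem ae_measure_setOf_norm_eq : ∀ᵐ t : ℝ, τ {y | ‖y‖ = t} = 0 := by
  have hcount := Measure.countable_meas_level_set_pos (μ := τ) (measurable_norm (α := V))
  filter_upwards [hcount.ae_notMem volume] with t ht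
  simpa using ht

theorem tendsto_integral_mul_integral_ball_mollifyMeasure {w : ℝ → ℝ} {a b : ℝ} (hab : a ≤ b)
    (hw : ContinuousOn w (Icc a b)) :
    Tendsto (fun ε => ∫ t in a..b, w t * ∫ x in ball 0 t, mollifyMeasure ε τ x) (𝓝[>] 0)
      (𝓝 (∫ t in a..b, w t * τ.real (closedBall 0 t))) := by
  have hpos : ∀ᶠ ε : ℝ in 𝓝[>] 0, 0 < ε := self_mem_nhdsWithin
  refine intervalIntegral.tendsto_integral_filter_of_dominated_convergence
    (fun t => ‖w t‖ * τ.real univ) (hpos.mono fun ε hε => ?_)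
    (hpos.mono fun ε hε => .of_forall fun t _ => ?_)
    ((hw.intervalIntegrable_of_Icc hab).norm.mul_const _)
    ((ae_measure_setOf_norm_eq τ).mono fun t ht _ =>
      (tendsto_integral_ball_mollifyMeasure τ ht).const_mul _)
  · have hmono := monotoneOn_setIntegral_ball (c := b) (continuous_mollifyMeasure τ hε)
      fun x _ => mollifyMeasure_nonneg ε τ x
    exact (intervalIntegrable_iff.1 (intervalIntegrable_mul_of_monotoneOn hab hw
      (hmono.mono Icc_subset_Iic_self))).aestronglyMeasurable
  · rw [norm_mul, Real.norm_of_nonneg (integral_nonneg fun x => mollifyMeasure_nonneg ε τ x)]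
    exact mul_le_mul_of_nonneg_left (integral_ball_mollifyMeasure_le τ hε t) (norm_nonneg _)

theorem tendsto_radialIncrement_mollifyMeasure {F : ℝ → V → ℝ} {f : V → ℝ} {a b : ℝ}
    (ha : 0 < a) (hab : a ≤ b) (C : ℝ)
    (hFa : Tendsto (fun ε => sphereIntegral (F ε) 0 a) (𝓝[>] 0) (𝓝 (sphereIntegral f 0 a)))
    (hFb : Tendsto (fun ε => sphereIntegral (F ε) 0 b) (𝓝[>] 0) (𝓝 (sphereIntegral f 0 b))) :
    Tendsto (fun ε => radialIncrement (F ε)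
        (fun t => ∫ x in ball 0 t, C * mollifyMeasure ε τ x) a b) (𝓝[>] 0)
      (𝓝 (radialIncrement f (fun t => C * τ.real (closedBall 0 t)) a b)) := by
  simp only [radialIncrement, integral_const_mul, mul_left_comm _ C,
    intervalIntegral.integral_const_mul]
  exact (hFb.sub hFa).add ((tendsto_integral_mul_integral_ball_mollifyMeasure τ hab
    (continuousOn_inv_pow _ ha)).const_mul C)

end MollifyMeasure

theorem dHat_pos (d : ℕ) : 0 < dHat d :=
  zero_lt_one.trans_le (le_max_left _ _)

namespace NontrivialSubharmonicOn

variable {d : ℕ} [NeZero d] {u : E d → EReal} {Ω : Set (E d)} {R ε : ℝ}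

theorem laplacian_regularize_eq (hu : NontrivialSubharmonicOn u Ω) {μ : Measure (E d)}
    (hμ : IsRieszMeasure Ω u μ) (hR : closedBall 0 R ⊆ Ω) (hε : 0 < ε) {x : E d}
    (hx : ‖x‖ + ε ≤ R) :
    (Δ (regularize u R ε)) x = sphereArea d * dHat d * mollifyMeasure ε μ x := by
  let φ : E d → ℝ := fun y => mollifier ε (x - y)
  have hφ : ContDiff ℝ ((⊤ : ℕ∞) : WithTop ℕ∞) φ :=
    contDiff_mollifier.comp (contDiff_const.sub contDiff_id)
  have hsub : closedBall x ε ⊆ closedBall 0 R := closedBall_subset_closedBall_zero hx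
  have hsupp : tsupport φ ⊆ closedBall x ε := by
    refine closure_minimal (fun y hy => ?_) isClosed_closedBall
    rw [mem_closedBall', dist_eq_norm]
    exact not_lt.1 fun h => hy (mollifier_eq_zero hε h.le)
  have hφK : HasCompactSupport φ :=
    (isCompact_closedBall x ε).of_isClosed_subset (isClosed_tsupport _) hsupp
  rw [mollifyMeasure, ← hμ.integral_eq φ hφ hφK (hsupp.trans (hsub.trans hR)), regularize, mollify,
    laplacian_convolution_mul (hu.integrable_truncate hR).locallyIntegrable
      (contDiff_mollifier (n := 2)) (hasCompactSupport_mollifier hε)]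
  refine integral_congr_ae (.of_forall fun y => ?_)
  simp only [← laplacian_comp_const_sub (contDiff_mollifier (n := 2))]
  change _ * (Δ φ) y = _ * (Δ φ) y
  by_cases hy : y ∈ tsupport φ
  · rw [truncate_of_mem (hsub (hsupp hy))]
  · rw [image_eq_zero_of_notMem_tsupport fun h => hy (tsupport_laplacian_subset φ h), mul_zero,
      mul_zero]

theorem integrable_abs_regularize_sub_sphere (hu : NontrivialSubharmonicOn u Ω)
    (hR : closedBall 0 R ⊆ Ω) {r : ℝ} (hr : 0 < r) (hrR : r < R) (hε : 0 < ε) :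
    Integrable (fun ω : sphere (0 : E d) 1 =>
      |regularize u R ε (0 + r • (ω : E d)) - (u (0 + r • (ω : E d))).toReal|)
      (volume : Measure (E d)).toSphere :=
  ((integrable_comp_unitSphere (hu.contDiff_regularize hR hε (n := 0)).continuous 0 r).sub
    (hu.erealIntegrable_sphere hR hr hrR).integrable).abs

end NontrivialSubharmonicOn

namespace DeltaSubharmonic

/-- The real-valued version of `U⁺`, with a junk value where `U.pos` or `U.neg` is `-∞`. -/
def realPos {d : ℕ} {Ω : Set (E d)} (U : DeltaSubharmonic Ω) (x : E d) : ℝ :=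
  max 0 ((U.pos x).toReal - (U.neg x).toReal)

/-- The smooth approximation of `U⁺` at scale `ε`; it is meaningful inside the ball of radius
`R - ε`. -/
def smoothPos {d : ℕ} {Ω : Set (E d)} (U : DeltaSubharmonic Ω) (R ε : ℝ) (x : E d) : ℝ :=
  smoothPosPart ε (regularize U.pos R ε x - regularize U.neg R ε x)

/-- The increment over `[a, b]` of the sphere integral of `U⁺`, plus the flux of the lower
variation. -/
def increment {d : ℕ} {Ω : Set (E d)} (U : DeltaSubharmonic Ω) (a b : ℝ) : ℝ :=
  radialIncrement U.realPos
    (fun t => sphereArea d * dHat d * U.lowerVariation.real (closedBall 0 t)) a b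

variable {d : ℕ} {ρ : ℝ≥0∞} (U : DeltaSubharmonic (eball (0 : E d) ρ)) {R r ε : ℝ}

theorem nontrivialSubharmonicOn_pos : NontrivialSubharmonicOn U.pos (eball 0 ρ) :=
  ⟨U.subharmonicOn_pos, isOpen_eball, (convex_eball _ _).isPreconnected, U.pos_nontrivial⟩

theorem nontrivialSubharmonicOn_neg : NontrivialSubharmonicOn U.neg (eball 0 ρ) :=
  ⟨U.subharmonicOn_neg, isOpen_eball, (convex_eball _ _).isPreconnected, U.neg_nontrivial⟩

theorem abs_smoothPos_sub_realPos_le (hε : 0 ≤ ε) (x : E d) :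
    |U.smoothPos R ε x - U.realPos x| ≤ ε + |regularize U.pos R ε x - (U.pos x).toReal| +
      |regularize U.neg R ε x - (U.neg x).toReal| := by
  set p := regularize U.pos R ε x
  set q := regularize U.neg R ε x
  set p₀ := (U.pos x).toReal
  set q₀ := (U.neg x).toReal
  calc |smoothPosPart ε (p - q) - max 0 (p₀ - q₀)|
      ≤ |smoothPosPart ε (p - q) - max 0 (p - q)| + |max 0 (p - q) - max 0 (p₀ - q₀)| :=
        abs_sub_le _ _ _
    _ ≤ ε + |(p - q) - (p₀ - q₀)| :=
        add_le_add (abs_smoothPosPart_sub_le hε _)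
          (by simpa using abs_max_sub_max_le_max 0 (p - q) 0 (p₀ - q₀))
    _ ≤ ε + |p - p₀| + |q - q₀| := by
        rw [sub_sub_sub_comm, add_assoc]
        exact add_le_add_right (abs_sub _ _) ε

variable [NeZero d]

theorem contDiff_smoothPos (hR : closedBall (0 : E d) R ⊆ eball 0 ρ) (hε : 0 < ε) :
    ContDiff ℝ 2 (U.smoothPos R ε) :=
  (contDiff_smoothPosPart hε (n := 2)).comp
    ((U.nontrivialSubharmonicOn_pos.contDiff_regularize hR hε (n := 2)).sub
      (U.nontrivialSubharmonicOn_neg.contDiff_regularize hR hε (n := 2)))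

theorem integrable_realPos_sphere (hR : closedBall (0 : E d) R ⊆ eball 0 ρ) (hr : 0 < r)
    (hrR : r < R) :
    Integrable (fun ω : sphere (0 : E d) 1 => U.realPos (0 + r • (ω : E d)))
      (volume : Measure (E d)).toSphere := by
  have := (U.nontrivialSubharmonicOn_pos.erealIntegrable_sphere hR hr hrR).integrable.sub
    (U.nontrivialSubharmonicOn_neg.erealIntegrable_sphere hR hr hrR).integrable
  simpa only [realPos, max_comm, Pi.sub_apply] using this.pos_part

theorem abs_sphereIntegral_smoothPos_sub_le (hR : closedBall (0 : E d) R ⊆ eball 0 ρ)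
    (hr : 0 < r) (hrR : r < R) (hε : 0 < ε) :
    |sphereIntegral (U.smoothPos R ε) 0 r - sphereIntegral U.realPos 0 r| ≤
      ε * sphereArea d +
        sphereIntegral (fun x => |regularize U.pos R ε x - (U.pos x).toReal|) 0 r +
        sphereIntegral (fun x => |regularize U.neg R ε x - (U.neg x).toReal|) 0 r := by
  have hconst : Integrable (fun _ : sphere (0 : E d) 1 => ε) (volume : Measure (E d)).toSphere :=
    integrable_const ε
  have hpos := U.nontrivialSubharmonicOn_pos.integrable_abs_regularize_sub_sphere hR hr hrR hε
  have hneg := U.nontrivialSubharmonicOn_neg.integrable_abs_regularize_sub_sphere hR hr hrR hε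
  have hsmooth := integrable_comp_unitSphere (U.contDiff_smoothPos hR hε).continuous 0 r
  have hreal := U.integrable_realPos_sphere hR hr hrR
  have harea : ε * sphereArea d = ∫ _, ε ∂(volume : Measure (E d)).toSphere := by
    rw [integral_const, toSphere_real_univ, smul_eq_mul, mul_comm]
  simp only [harea, sphereIntegral]
  rw [← integral_add' hconst hpos, ← integral_add' (hconst.add hpos) hneg,
    ← integral_sub hsmooth hreal]
  exact abs_integral_le_integral_abs.trans (integral_mono (hsmooth.sub hreal).abs
    ((hconst.add hpos).add hneg) fun ω => U.abs_smoothPos_sub_realPos_le hε.le _)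

theorem tendsto_sphereIntegral_smoothPos (hR : closedBall (0 : E d) R ⊆ eball 0 ρ) (hr : 0 < r)
    (hrR : r < R) :
    Tendsto (fun ε => sphereIntegral (U.smoothPos R ε) 0 r) (𝓝[>] 0)
      (𝓝 (sphereIntegral U.realPos 0 r)) := by
  have hbound : Tendsto (fun ε : ℝ => ε * sphereArea d) (𝓝[>] 0) (𝓝 0) := by
    simpa using (tendsto_id.mul_const (sphereArea d)).mono_left
      (nhdsWithin_le_nhds (a := (0 : ℝ)) (s := Ioi 0))
  have hlim := (hbound.add
    (U.nontrivialSubharmonicOn_pos.tendsto_sphereIntegral_abs_regularize_sub hR hr hrR)).add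
    (U.nontrivialSubharmonicOn_neg.tendsto_sphereIntegral_abs_regularize_sub hR hr hrR)
  simp only [add_zero] at hlim
  rw [tendsto_iff_norm_sub_tendsto_zero]
  refine squeeze_zero' (.of_forall fun _ => norm_nonneg _) ?_ hlim
  filter_upwards [self_mem_nhdsWithin] with ε hε
  exact U.abs_sphereIntegral_smoothPos_sub_le hR hr hrR hε

theorem lowerVariation_closedBall_lt_top (hR : closedBall (0 : E d) R ⊆ eball 0 ρ) :
    U.lowerVariation (closedBall 0 R) < ⊤ :=
  (Measure.sub_le _).trans_lt
    (U.nontrivialSubharmonicOn_neg.isRieszMeasure_rieszMeasure.lt_top_of_isCompact _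
      (isCompact_closedBall 0 R) hR)

theorem mollifyMeasure_rieszMeasure_neg_le (hR : closedBall (0 : E d) R ⊆ eball 0 ρ)
    (hε : 0 < ε) {x : E d} (hx : ‖x‖ + ε ≤ R) :
    mollifyMeasure ε (rieszMeasure (eball 0 ρ) U.neg) x ≤
      mollifyMeasure ε (U.lowerVariation.restrict (closedBall 0 R)) x +
        mollifyMeasure ε (rieszMeasure (eball 0 ρ) U.pos) x := by
  set μ := rieszMeasure (eball 0 ρ) U.pos
  set ν := rieszMeasure (eball 0 ρ) U.neg
  set K := closedBall (0 : E d) R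
  have hfinite {τ : Measure (E d)} (hτ : τ K < ⊤) : IsFiniteMeasure (τ.restrict K) :=
    ⟨by rwa [Measure.restrict_apply_univ]⟩
  have hK : IsCompact K := isCompact_closedBall 0 R
  have := hfinite
    (U.nontrivialSubharmonicOn_pos.isRieszMeasure_rieszMeasure.lt_top_of_isCompact K hK hR)
  have := hfinite
    (U.nontrivialSubharmonicOn_neg.isRieszMeasure_rieszMeasure.lt_top_of_isCompact K hK hR)
  have := hfinite (U.lowerVariation_closedBall_lt_top hR)
  have hle : ν.restrict K ≤ U.lowerVariation.restrict K + μ.restrict K := by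
    rw [← Measure.sub_le_iff_le_add, lowerVariation,
      Measure.restrict_sub_eq_restrict_sub_restrict measurableSet_closedBall]
  rw [← mollifyMeasure_restrict μ hε hx, ← mollifyMeasure_restrict ν hε hx, mollifyMeasure,
    mollifyMeasure, mollifyMeasure, ← integral_add_measure (integrable_mollifier_sub _ hε x)
      (integrable_mollifier_sub _ hε x)]
  exact integral_mono_measure hle (.of_forall fun y => mollifier_nonneg ε _)
    (integrable_mollifier_sub _ hε x)

theorem neg_le_laplacian_smoothPos (hR : closedBall (0 : E d) R ⊆ eball 0 ρ) (hε : 0 < ε)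
    {x : E d} (hx : ‖x‖ + ε ≤ R) :
    -(sphereArea d * dHat d *
        mollifyMeasure ε (U.lowerVariation.restrict (closedBall 0 R)) x) ≤
      (Δ (U.smoothPos R ε)) x := by
  have hpos := U.nontrivialSubharmonicOn_pos
  have hneg := U.nontrivialSubharmonicOn_neg
  have hc : 0 ≤ sphereArea d * dHat d := (mul_pos sphereArea_pos (dHat_pos d)).le
  have hpos₂ := hpos.contDiff_regularize hR hε (n := 2)
  have hneg₂ := hneg.contDiff_regularize hR hε (n := 2)
  have hsub : (Δ fun x => regularize U.pos R ε x - regularize U.neg R ε x) x =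
      (Δ (regularize U.pos R ε)) x - (Δ (regularize U.neg R ε)) x :=
    hpos₂.contDiffAt.laplacian_sub hneg₂.contDiffAt
  refine neg_le_laplacian_smoothPosPart_comp hε (hpos₂.sub hneg₂)
    (mul_nonneg hc (mollifyMeasure_nonneg ε _ x)) ?_
  rw [hsub, hpos.laplacian_regularize_eq hpos.isRieszMeasure_rieszMeasure hR hε hx,
    hneg.laplacian_regularize_eq hneg.isRieszMeasure_rieszMeasure hR hε hx, ← mul_sub,
    neg_mul_eq_mul_neg]
  refine mul_le_mul_of_nonneg_left ?_ hc
  linarith [U.mollifyMeasure_rieszMeasure_neg_le hR hε hx]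

theorem tendsto_increment (hR : closedBall (0 : E d) R ⊆ eball 0 ρ) {a b : ℝ} (ha : 0 < a)
    (hab : a ≤ b) (hbR : b < R) :
    Tendsto (fun ε => radialIncrement (U.smoothPos R ε) (fun t => ∫ x in ball 0 t,
        sphereArea d * dHat d * mollifyMeasure ε (U.lowerVariation.restrict (closedBall 0 R)) x)
        a b) (𝓝[>] 0) (𝓝 (U.increment a b)) := by
  have : IsFiniteMeasure (U.lowerVariation.restrict (closedBall 0 R)) :=
    ⟨by rw [Measure.restrict_apply_univ]; exact U.lowerVariation_closedBall_lt_top hR⟩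
  have hlim := tendsto_radialIncrement_mollifyMeasure
    (U.lowerVariation.restrict (closedBall 0 R)) ha hab (sphereArea d * dHat d)
    (U.tendsto_sphereIntegral_smoothPos hR ha (hab.trans_lt hbR))
    (U.tendsto_sphereIntegral_smoothPos hR (ha.trans_le hab) hbR)
  convert hlim using 2
  rw [increment, radialIncrement, radialIncrement]
  congr 1
  refine intervalIntegral.integral_congr fun t ht => ?_
  rw [uIcc_of_le hab] at ht
  simp only [measureReal_restrict_apply measurableSet_closedBall,
    inter_eq_left.2 (closedBall_subset_closedBall (ht.2.trans hbR.le))]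

theorem increment_nonneg (hR : closedBall (0 : E d) R ⊆ eball 0 ρ) {a b : ℝ} (ha : 0 < a)
    (hab : a ≤ b) (hbR : b < R) : 0 ≤ U.increment a b := by
  have : IsFiniteMeasure (U.lowerVariation.restrict (closedBall 0 R)) :=
    ⟨by rw [Measure.restrict_apply_univ]; exact U.lowerVariation_closedBall_lt_top hR⟩
  refine ge_of_tendsto (U.tendsto_increment hR ha hab hbR) ?_
  filter_upwards [Ioo_mem_nhdsGT (sub_pos.2 hbR)] with ε hε
  refine radialIncrement_nonneg (U.contDiff_smoothPos hR hε.1)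
    (continuous_const.mul (continuous_mollifyMeasure _ hε.1))
    (fun x => mul_nonneg (mul_pos sphereArea_pos (dHat_pos d)).le (mollifyMeasure_nonneg ε _ x))
    ha hab fun x hx => U.neg_le_laplacian_smoothPos hR hε.1 ?_
  linarith [mem_ball_zero_iff.1 hx, hε.2]

theorem integral_mul_increment_le (hR : closedBall (0 : E d) R ⊆ eball 0 ρ) {a b c : ℝ}
    (ha : 0 < a) (hab : a ≤ b) (hbc : b ≤ c) (hcR : c < R) :
    (∫ t in b..c, (t ^ (d - 1))⁻¹) * U.increment a b ≤
      (∫ t in a..b, (t ^ (d - 1))⁻¹) * U.increment b c := by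
  have : IsFiniteMeasure (U.lowerVariation.restrict (closedBall 0 R)) :=
    ⟨by rw [Measure.restrict_apply_univ]; exact U.lowerVariation_closedBall_lt_top hR⟩
  refine le_of_tendsto_of_tendsto
    ((U.tendsto_increment hR ha hab (hbc.trans_lt hcR)).const_mul _)
    ((U.tendsto_increment hR (ha.trans_le hab) hbc hcR).const_mul _) ?_
  filter_upwards [Ioo_mem_nhdsGT (sub_pos.2 hcR)] with ε hε
  have hle := integral_mul_radialIncrement_le (U.contDiff_smoothPos hR hε.1)
    (continuous_const.mul (continuous_mollifyMeasure _ hε.1))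
    (fun x => mul_nonneg (mul_pos sphereArea_pos (dHat_pos d)).le (mollifyMeasure_nonneg ε _ x))
    ha hab hbc fun x hx => U.neg_le_laplacian_smoothPos hR hε.1
      (by linarith [mem_ball_zero_iff.1 hx, hε.2])
  rwa [finrank_euclideanSpace_fin] at hle

end DeltaSubharmonic

section Kernel

variable {d : ℕ}

theorem dHat_add_three (m : ℕ) : dHat (m + 3) = m + 1 := by
  rw [dHat, max_eq_right] <;> push_cast <;> linarith [Nat.cast_nonneg (α := ℝ) m]

theorem hasDerivAt_kernel (hd : 2 ≤ d) {t : ℝ} (ht : 0 < t) :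
    HasDerivAt (kernel d) (dHat d * (t ^ (d - 1))⁻¹) t := by
  rcases hd.eq_or_lt with rfl | hd
  · have hlog : kernel 2 = Real.log := by ext; simp only [kernel, if_true]
    rw [hlog]
    exact (Real.hasDerivAt_log ht.ne').congr_deriv (by norm_num [dHat])
  · obtain ⟨m, rfl⟩ : ∃ m, d = m + 3 := ⟨d - 3, by omega⟩
    have hpow : kernel (m + 3) = fun s : ℝ => -(s ^ (m + 1))⁻¹ := by
      ext s
      rw [kernel, if_neg (by omega), one_div, show m + 3 - 2 = m + 1 from rfl]
    rw [hpow, dHat_add_three, show m + 3 - 1 = m + 2 from rfl]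
    refine ((hasDerivAt_pow (m + 1) t).inv (pow_pos ht _).ne').neg.congr_deriv ?_
    field_simp
    push_cast
    ring

theorem strictMonoOn_kernel (hd : 2 ≤ d) : StrictMonoOn (kernel d) (Ioi 0) := by
  refine strictMonoOn_of_deriv_pos (convex_Ioi 0)
    (fun t ht => (hasDerivAt_kernel hd ht).continuousAt.continuousWithinAt) fun t ht => ?_
  rw [interior_Ioi] at ht
  rw [(hasDerivAt_kernel hd ht).deriv]
  exact mul_pos (dHat_pos d) (inv_pos.2 (pow_pos ht _))

theorem kernel_sub (hd : 2 ≤ d) {a b : ℝ} (ha : 0 < a) (hab : a ≤ b) :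
    kernel d b - kernel d a = dHat d * ∫ t in a..b, (t ^ (d - 1))⁻¹ := by
  rw [← intervalIntegral.integral_const_mul]
  refine (intervalIntegral.integral_eq_sub_of_hasDerivAt (fun t ht => ?_) ?_).symm
  · rw [uIcc_of_le hab] at ht
    exact hasDerivAt_kernel hd (ha.trans_le ht.1)
  · exact ((continuousOn_inv_pow (d - 1) ha).intervalIntegrable_of_Icc hab).const_mul _

theorem convex_kernel_image (hd : 2 ≤ d) {I : Set ℝ} (hI : I.OrdConnected) (hI₀ : I ⊆ Ioi 0) :
    Convex ℝ (kernel d '' I) :=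
  Real.convex_iff_isPreconnected.2 (hI.isPreconnected.image _ fun _ ht =>
    (hasDerivAt_kernel hd (hI₀ ht)).continuousAt.continuousWithinAt)

theorem convexWrt_kernel_of_adjacent (hd : 2 ≤ d) {I : Set ℝ} (hI : I.OrdConnected)
    (hI₀ : I ⊆ Ioi 0) {f : ℝ → ℝ}
    (h : ∀ a ∈ I, ∀ b ∈ I, ∀ c ∈ I, a < b → b < c →
      (∫ t in b..c, (t ^ (d - 1))⁻¹) * (f b - f a) ≤
        (∫ t in a..b, (t ^ (d - 1))⁻¹) * (f c - f b)) :
    ConvexWrt (kernel d) I f := by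
  have hmono : StrictMonoOn (kernel d) I := (strictMonoOn_kernel hd).mono hI₀
  have hinv : ∀ a ∈ I, Function.invFunOn (kernel d) I (kernel d a) = a := fun a ha =>
    hmono.injOn.leftInvOn_invFunOn ha
  have hconv := convex_kernel_image hd hI hI₀
  refine convexOn_of_slope_mono_adjacent hconv fun {x y z} hx hz hxy hyz => ?_
  have hy : y ∈ kernel d '' I := hconv.ordConnected.out hx hz ⟨hxy.le, hyz.le⟩
  obtain ⟨a, ha, rfl⟩ := hx
  obtain ⟨b, hb, rfl⟩ := hy
  obtain ⟨c, hc, rfl⟩ := hz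
  have hab := (hmono.lt_iff_lt ha hb).1 hxy
  have hbc := (hmono.lt_iff_lt hb hc).1 hyz
  simp only [Function.comp_apply, hinv a ha, hinv b hb, hinv c hc]
  rw [div_le_div_iff₀ (sub_pos.2 hxy) (sub_pos.2 hyz), kernel_sub hd (hI₀ ha) hab.le,
    kernel_sub hd (hI₀ hb) hbc.le]
  linarith [mul_le_mul_of_nonneg_left (h a ha b hb c hc hab hbc) (dHat_pos d).le]

theorem concaveWrt_kernel_of_adjacent (hd : 2 ≤ d) {I : Set ℝ} (hI : I.OrdConnected)
    (hI₀ : I ⊆ Ioi 0) {f : ℝ → ℝ}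
    (h : ∀ a ∈ I, ∀ b ∈ I, ∀ c ∈ I, a < b → b < c →
      (∫ t in a..b, (t ^ (d - 1))⁻¹) * (f c - f b) ≤
        (∫ t in b..c, (t ^ (d - 1))⁻¹) * (f b - f a)) :
    ConcaveWrt (kernel d) I f := by
  refine neg_convexOn_iff.1 (convexWrt_kernel_of_adjacent hd hI hI₀ (f := -f)
    fun a ha b hb c hc hab hbc => ?_)
  simp only [Pi.neg_apply]
  linarith [h a ha b hb c hc hab hbc]

end Kernel

theorem countingN_add {d : ℕ} (μ : Measure (E d)) {r a R : ℝ} (hra : r ≤ a) (haR : a ≤ R) :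
    countingN μ r R = countingN μ r a + countingN μ a R := by
  rw [countingN, countingN, countingN, ← mul_add, ← lintegral_union measurableSet_Ioc
    (Ioc_disjoint_Ioc_of_le le_rfl), Ioc_union_Ioc_eq_Ioc hra haR]

theorem countingN_anti_left {d : ℕ} (μ : Measure (E d)) {r a : ℝ} (hra : r ≤ a) (R : ℝ) :
    countingN μ a R ≤ countingN μ r R :=
  mul_le_mul_right (lintegral_mono_set (Ioc_subset_Ioc_left hra)) _

theorem exists_lt_closedBall_subset_eball {d : ℕ} {ρ : ℝ≥0∞} {R : ℝ}
    (hR : ENNReal.ofReal R < ρ) : ∃ R', R < R' ∧ closedBall (0 : E d) R' ⊆ eball 0 ρ := by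
  obtain ⟨R', -, hRR', hR'⟩ := ENNReal.lt_iff_exists_real_btwn.1 hR
  exact ⟨R', (ENNReal.ofReal_lt_ofReal_iff'.1 hRR').1, closedBall_zero_subset_eball_zero hR'⟩

namespace DeltaSubharmonic

/-- The mean of `U⁺` over the sphere of radius `R` centred at `0`, as a real number. -/
def meanPos {d : ℕ} {Ω : Set (E d)} (U : DeltaSubharmonic Ω) (R : ℝ) : ℝ :=
  (sphereArea d)⁻¹ * sphereIntegral U.realPos 0 R

/-- The counting function of the lower variation, as a real number. It is meaningful for `0 < r`:
at `r = 0` the integral may diverge, and then has the junk value `0`. -/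
def realN {d : ℕ} {Ω : Set (E d)} (U : DeltaSubharmonic Ω) (r R : ℝ) : ℝ :=
  dHat d * ∫ t in r..R, (t ^ (d - 1))⁻¹ * U.lowerVariation.real (closedBall 0 t)

section

variable {d : ℕ} {Ω : Set (E d)} (U : DeltaSubharmonic Ω)

theorem realN_self (r : ℝ) : U.realN r r = 0 := by
  rw [realN, intervalIntegral.integral_same, mul_zero]

theorem realN_nonneg {r R : ℝ} (hr : 0 < r) (hrR : r ≤ R) : 0 ≤ U.realN r R :=
  mul_nonneg (dHat_pos d).le (intervalIntegral.integral_nonneg hrR fun t ht =>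
    mul_nonneg (inv_pow_nonneg_of_mem_Icc _ hr t ht) measureReal_nonneg)

variable [NeZero d]

theorem meanPos_nonneg (R : ℝ) : 0 ≤ U.meanPos R :=
  mul_nonneg (inv_nonneg.2 sphereArea_pos.le) (integral_nonneg fun _ => le_max_left _ _)

theorem increment_eq (a b : ℝ) :
    U.increment a b = sphereArea d * (U.meanPos b - U.meanPos a + U.realN a b) := by
  have hscale (t : ℝ) : (t ^ (d - 1))⁻¹ * (sphereArea d * dHat d *
      U.lowerVariation.real (closedBall 0 t)) =
      sphereArea d * dHat d * ((t ^ (d - 1))⁻¹ * U.lowerVariation.real (closedBall 0 t)) :=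
    mul_left_comm _ _ _
  have hne := (sphereArea_pos (d := d)).ne'
  simp only [increment, radialIncrement, finrank_euclideanSpace_fin, hscale,
    intervalIntegral.integral_const_mul, meanPos, realN]
  field_simp

end

section

variable {d : ℕ} [NeZero d] {ρ : ℝ≥0∞} (U : DeltaSubharmonic (eball (0 : E d) ρ)) {r R : ℝ}

theorem sphereMean_eq_meanPos (hR₀ : 0 < R) (hR : ENNReal.ofReal R < ρ) :
    sphereMean (fun x => max 0 (U.val x)) 0 R = (U.meanPos R : EReal) := by
  obtain ⟨R', hRR', hR'⟩ := exists_lt_closedBall_subset_eball (d := d) hR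
  have hval : ∀ᵐ ω : sphere (0 : E d) 1 ∂(volume : Measure (E d)).toSphere,
      max 0 (U.val (0 + R • (ω : E d))) = (U.realPos (0 + R • (ω : E d)) : EReal) := by
    filter_upwards
      [(U.nontrivialSubharmonicOn_pos.erealIntegrable_sphere hR' hR₀ hRR').ae_eq_coe,
        (U.nontrivialSubharmonicOn_neg.erealIntegrable_sphere hR' hR₀ hRR').ae_eq_coe]
      with ω hpos hneg
    rw [val, realPos, hpos, hneg, ← EReal.coe_sub, ← EReal.coe_zero,
      ← EReal.coe_strictMono.monotone.map_max, EReal.toReal_coe, EReal.toReal_coe]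
  rw [sphereMean, extIntegral_eq_integral (U.integrable_realPos_sphere hR' hR₀ hRR') hval,
    ← EReal.coe_mul]
  rfl

theorem monotoneOn_lowerVariation_real (hR : ENNReal.ofReal R < ρ) :
    MonotoneOn (fun t => U.lowerVariation.real (closedBall (0 : E d) t)) (Iic R) := by
  intro s _ t ht hst
  refine measureReal_mono (closedBall_subset_closedBall hst) (ne_of_lt ?_)
  exact U.lowerVariation_closedBall_lt_top
    (closedBall_zero_subset_eball_zero ((ENNReal.ofReal_le_ofReal ht).trans_lt hR))

theorem intervalIntegrable_inv_pow_mul_lowerVariation (hr : 0 < r) (hrR : r ≤ R)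
    (hR : ENNReal.ofReal R < ρ) :
    IntervalIntegrable (fun t => (t ^ (d - 1))⁻¹ * U.lowerVariation.real (closedBall (0 : E d) t))
      volume r R :=
  intervalIntegrable_mul_of_monotoneOn hrR (continuousOn_inv_pow (d - 1) hr)
    ((U.monotoneOn_lowerVariation_real hR).mono Icc_subset_Iic_self)

theorem realN_add {a b c : ℝ} (ha : 0 < a) (hab : a ≤ b) (hbc : b ≤ c)
    (hc : ENNReal.ofReal c < ρ) : U.realN a b + U.realN b c = U.realN a c := by
  rw [realN, realN, realN, ← mul_add, intervalIntegral.integral_add_adjacent_intervals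
    (U.intervalIntegrable_inv_pow_mul_lowerVariation ha hab
      ((ENNReal.ofReal_le_ofReal hbc).trans_lt hc))
    (U.intervalIntegrable_inv_pow_mul_lowerVariation (ha.trans_le hab) hbc hc)]

theorem integral_mul_realN_le {a b c : ℝ} (ha : 0 < a) (hab : a ≤ b) (hbc : b ≤ c)
    (hc : ENNReal.ofReal c < ρ) :
    (∫ t in b..c, (t ^ (d - 1))⁻¹) * U.realN a b ≤
      (∫ t in a..b, (t ^ (d - 1))⁻¹) * U.realN b c := by
  rw [realN, realN, mul_left_comm, mul_left_comm _ (dHat d)]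
  exact mul_le_mul_of_nonneg_left (integral_mul_integral_le_of_monotoneOn hab hbc
    (continuousOn_inv_pow _ ha) (inv_pow_nonneg_of_mem_Icc _ ha)
    ((U.monotoneOn_lowerVariation_real hc).mono Icc_subset_Iic_self)) (dHat_pos d).le

theorem countingN_eq_realN (hr : 0 < r) (hrR : r ≤ R) (hR : ENNReal.ofReal R < ρ) :
    countingN U.lowerVariation r R = ENNReal.ofReal (U.realN r R) := by
  rw [countingN, realN, ENNReal.ofReal_mul (dHat_pos d).le, intervalIntegral.integral_of_le hrR,
    ofReal_integral_eq_lintegral_ofReal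
      (U.intervalIntegrable_inv_pow_mul_lowerVariation hr hrR hR).1]
  · congr 1
    refine setLIntegral_congr_fun measurableSet_Ioc fun t ht => ?_
    have hpow : 0 < t ^ (d - 1) := pow_pos (hr.trans ht.1) _
    have hfin := U.lowerVariation_closedBall_lt_top
      (closedBall_zero_subset_eball_zero ((ENNReal.ofReal_le_ofReal ht.2).trans_lt hR))
    rw [ENNReal.ofReal_mul (inv_nonneg.2 hpow.le), ENNReal.ofReal_inv_of_pos hpow,
      ofReal_measureReal hfin.ne, div_eq_mul_inv, mul_comm]
  · filter_upwards [ae_restrict_mem measurableSet_Ioc] with t ht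
    exact mul_nonneg (inv_pow_nonneg_of_mem_Icc _ hr t (Ioc_subset_Icc_self ht))
      measureReal_nonneg

theorem countingN_ne_top (hr : 0 < r) (hrR : r ≤ R) (hR : ENNReal.ofReal R < ρ) :
    countingN U.lowerVariation r R ≠ ⊤ := by
  rw [U.countingN_eq_realN hr hrR hR]
  exact ENNReal.ofReal_ne_top

theorem nevanlinnaT_eq_top_iff (hR₀ : 0 < R) (hR : ENNReal.ofReal R < ρ) :
    nevanlinnaT U r R = ⊤ ↔ countingN U.lowerVariation r R = ⊤ := by
  rw [nevanlinnaT, U.sphereMean_eq_meanPos hR₀ hR, ← not_iff_not, ← ne_eq,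
    EReal.add_ne_top_iff_ne_top_right (EReal.coe_ne_bot _) (EReal.coe_ne_top _), ne_eq,
    EReal.coe_ennreal_eq_top_iff]

theorem nevanlinnaT_eq_coe {a : ℝ} (hra : r ≤ a) (ha : 0 < a) (haR : a ≤ R)
    (hR : ENNReal.ofReal R < ρ) (hfin : countingN U.lowerVariation r a ≠ ⊤) :
    nevanlinnaT U r R =
      ((U.meanPos R + ((countingN U.lowerVariation r a).toReal + U.realN a R) : ℝ) : EReal) := by
  have hN := U.realN_nonneg ha haR
  rw [nevanlinnaT, U.sphereMean_eq_meanPos (ha.trans_le haR) hR, countingN_add _ hra haR,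
    U.countingN_eq_realN ha haR hR, EReal.coe_ennreal_add, EReal.coe_ennreal_ofReal,
    max_eq_left hN, ← EReal.coe_ennreal_toReal hfin, EReal.coe_add, EReal.coe_add]

theorem toReal_nevanlinnaT (hr : 0 < r) (hrR : r ≤ R) (hR : ENNReal.ofReal R < ρ) :
    (nevanlinnaT U r R).toReal = U.meanPos R + U.realN r R := by
  have hzero : countingN U.lowerVariation r r = 0 := by
    rw [countingN, Ioc_self, Measure.restrict_empty, lintegral_zero_measure, mul_zero]
  rw [U.nevanlinnaT_eq_coe le_rfl hr hrR hR (hzero.trans_ne ENNReal.zero_ne_top), hzero,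
    EReal.toReal_coe, ENNReal.toReal_zero, zero_add]

theorem toReal_nevanlinnaT_sub {a b : ℝ} (ha : 0 < a) (hra : r ≤ a) (hab : a ≤ b)
    (hb : ENNReal.ofReal b < ρ) (hfin : countingN U.lowerVariation r a ≠ ⊤) :
    (nevanlinnaT U r b).toReal - (nevanlinnaT U r a).toReal =
      U.meanPos b - U.meanPos a + U.realN a b := by
  rw [U.nevanlinnaT_eq_coe hra ha le_rfl ((ENNReal.ofReal_le_ofReal hab).trans_lt hb) hfin,
    U.nevanlinnaT_eq_coe hra ha hab hb hfin, EReal.toReal_coe, EReal.toReal_coe, realN_self]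
  ring

theorem meanPos_sub_add_realN_nonneg {a b : ℝ} (ha : 0 < a) (hab : a ≤ b)
    (hb : ENNReal.ofReal b < ρ) : 0 ≤ U.meanPos b - U.meanPos a + U.realN a b := by
  obtain ⟨R', hbR', hR'⟩ := exists_lt_closedBall_subset_eball (d := d) hb
  have h := U.increment_nonneg hR' ha hab hbR'
  rw [U.increment_eq] at h
  exact nonneg_of_mul_nonneg_right h sphereArea_pos

theorem integral_mul_meanPos_sub_add_realN_le {a b c : ℝ} (ha : 0 < a) (hab : a ≤ b) (hbc : b ≤ c)
    (hc : ENNReal.ofReal c < ρ) :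
    (∫ t in b..c, (t ^ (d - 1))⁻¹) * (U.meanPos b - U.meanPos a + U.realN a b) ≤
      (∫ t in a..b, (t ^ (d - 1))⁻¹) * (U.meanPos c - U.meanPos b + U.realN b c) := by
  obtain ⟨R', hcR', hR'⟩ := exists_lt_closedBall_subset_eball (d := d) hc
  have h := U.integral_mul_increment_le hR' ha hab hbc hcR'
  rw [U.increment_eq, U.increment_eq, mul_left_comm, mul_left_comm _ (sphereArea d)] at h
  exact le_of_mul_le_mul_left h sphereArea_pos

theorem nevanlinnaT_nonneg (r : ℝ) (hR₀ : 0 < R) (hR : ENNReal.ofReal R < ρ) :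
    0 ≤ nevanlinnaT U r R := by
  rw [nevanlinnaT, U.sphereMean_eq_meanPos hR₀ hR]
  exact add_nonneg (EReal.coe_nonneg.2 (U.meanPos_nonneg R)) (EReal.coe_ennreal_nonneg _)

theorem nevanlinnaT_ne_top (hr : 0 < r) (hrR : r ≤ R) (hR : ENNReal.ofReal R < ρ) :
    nevanlinnaT U r R ≠ ⊤ :=
  (U.nevanlinnaT_eq_top_iff (hr.trans_le hrR) hR).not.2 (U.countingN_ne_top hr hrR hR)

theorem monotoneOn_nevanlinnaT (hr : 0 ≤ r) :
    MonotoneOn (fun R => nevanlinnaT U r R) {R : ℝ | r < R ∧ ENNReal.ofReal R < ρ} := by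
  rintro a ⟨hra, ha⟩ b ⟨hrb, hb⟩ hab
  have ha₀ := hr.trans_lt hra
  by_cases hfin : countingN U.lowerVariation r a = ⊤
  · have htop : countingN U.lowerVariation r b = ⊤ := by
      rw [countingN_add _ hra.le hab, hfin, top_add]
    exact le_top.trans_eq ((U.nevanlinnaT_eq_top_iff (hr.trans_lt hrb) hb).2 htop).symm
  · simp only [U.nevanlinnaT_eq_coe hra.le ha₀ le_rfl ha hfin,
      U.nevanlinnaT_eq_coe hra.le ha₀ hab hb hfin, EReal.coe_le_coe_iff, realN_self]
    linarith [U.meanPos_sub_add_realN_nonneg ha₀ hab hb]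

theorem nevanlinnaT_eq_top_congr {a b : ℝ} (hr : 0 ≤ r) (hra : r < a) (hab : a ≤ b)
    (hb : ENNReal.ofReal b < ρ) : nevanlinnaT U r b = ⊤ ↔ nevanlinnaT U r a = ⊤ := by
  have ha₀ := hr.trans_lt hra
  rw [U.nevanlinnaT_eq_top_iff (ha₀.trans_le hab) hb,
    U.nevanlinnaT_eq_top_iff ha₀ ((ENNReal.ofReal_le_ofReal hab).trans_lt hb),
    countingN_add _ hra.le hab, ENNReal.add_eq_top, or_iff_left (U.countingN_ne_top ha₀ hab hb)]

theorem nevanlinnaT_eq_top_or_ne_top (hr : 0 ≤ r) :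
    (∀ R : ℝ, r < R → ENNReal.ofReal R < ρ → nevanlinnaT U r R = ⊤) ∨
      ∀ R : ℝ, r < R → ENNReal.ofReal R < ρ → nevanlinnaT U r R ≠ ⊤ := by
  by_contra! ⟨⟨a, hra, ha, hne⟩, b, hrb, hb, htop⟩
  rcases le_total a b with hab | hba
  · exact hne ((U.nevanlinnaT_eq_top_congr hr hra hab hb).1 htop)
  · exact hne ((U.nevanlinnaT_eq_top_congr hr hrb hba ha).2 htop)

end

section

variable {d : ℕ} {ρ : ℝ≥0∞} {r R : ℝ}

theorem antitone_nevanlinnaT {Ω : Set (E d)} (U : DeltaSubharmonic Ω) (R : ℝ) :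
    Antitone fun r => nevanlinnaT U r R := fun _ _ hrs =>
  add_le_add le_rfl (EReal.coe_ennreal_le_coe_ennreal_iff.2 (countingN_anti_left _ hrs R))

variable (U : DeltaSubharmonic (eball (0 : E d) ρ))

theorem convexWrt_nevanlinnaT (hd : 2 ≤ d) (hr : 0 ≤ r)
    (hfin : ∀ R : ℝ, r < R → ENNReal.ofReal R < ρ → nevanlinnaT U r R ≠ ⊤) :
    ConvexWrt (kernel d) {R : ℝ | r < R ∧ ENNReal.ofReal R < ρ}
      (fun R => (nevanlinnaT U r R).toReal) := by
  have : NeZero d := ⟨by omega⟩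
  have hI : OrdConnected {R : ℝ | r < R ∧ ENNReal.ofReal R < ρ} :=
    ⟨fun a ha b hb t ht =>
      ⟨ha.1.trans_le ht.1, (ENNReal.ofReal_le_ofReal ht.2).trans_lt hb.2⟩⟩
  have hN : ∀ R : ℝ, r < R → ENNReal.ofReal R < ρ → countingN U.lowerVariation r R ≠ ⊤ :=
    fun R hrR hR => (U.nevanlinnaT_eq_top_iff (hr.trans_lt hrR) hR).not.1 (hfin R hrR hR)
  refine convexWrt_kernel_of_adjacent hd hI (fun a ha => hr.trans_lt ha.1)
    fun a ha b hb c hc hab hbc => ?_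
  have ha₀ := hr.trans_lt ha.1
  rw [U.toReal_nevanlinnaT_sub ha₀ ha.1.le hab.le hb.2 (hN a ha.1 ha.2),
    U.toReal_nevanlinnaT_sub (ha₀.trans hab) hb.1.le hbc.le hc.2 (hN b hb.1 hb.2)]
  exact U.integral_mul_meanPos_sub_add_realN_le ha₀ hab.le hbc.le hc.2

theorem concaveWrt_nevanlinnaT (hd : 2 ≤ d) (hR : ENNReal.ofReal R < ρ) :
    ConcaveWrt (kernel d) (Ioo 0 R) (fun r => (nevanlinnaT U r R).toReal) := by
  have : NeZero d := ⟨by omega⟩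
  refine concaveWrt_kernel_of_adjacent hd ordConnected_Ioo (fun a ha => ha.1)
    fun a ha b hb c hc hab hbc => ?_
  have hcR := (ENNReal.ofReal_le_ofReal hc.2.le).trans_lt hR
  rw [U.toReal_nevanlinnaT ha.1 ha.2.le hR, U.toReal_nevanlinnaT hb.1 hb.2.le hR,
    U.toReal_nevanlinnaT hc.1 hc.2.le hR, ← U.realN_add ha.1 hab.le hb.2.le hR,
    ← U.realN_add hb.1 hbc.le hc.2.le hR]
  linarith [U.integral_mul_realN_le ha.1 hab.le hbc.le hcR]

end

end DeltaSubharmonic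

end

end DiffNevanlinna

theorem mainTheorem2 (d : ℕ) (hd : 2 ≤ d) (ρ : ℝ≥0∞)
    (U : DiffNevanlinna.DeltaSubharmonic (Metric.eball (0 : DiffNevanlinna.E d) ρ)) :
    -- positivity, and finiteness for `r > 0`
    (∀ r R : ℝ, 0 ≤ r → r < R → ENNReal.ofReal R < ρ →
      0 ≤ DiffNevanlinna.nevanlinnaT U r R ∧
      (0 < r → DiffNevanlinna.nevanlinnaT U r R ≠ ⊤)) ∧
    -- in the second variable: increasing, and convex with respect to the kernel
    -- (for `r = 0` the characteristic may be identically `+∞`)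
    (∀ r : ℝ, 0 ≤ r →
      MonotoneOn (fun R => DiffNevanlinna.nevanlinnaT U r R)
        {R : ℝ | r < R ∧ ENNReal.ofReal R < ρ} ∧
      ((r = 0 ∧ ∀ R : ℝ, r < R → ENNReal.ofReal R < ρ →
          DiffNevanlinna.nevanlinnaT U r R = ⊤) ∨
        ((∀ R : ℝ, r < R → ENNReal.ofReal R < ρ → DiffNevanlinna.nevanlinnaT U r R ≠ ⊤) ∧
          DiffNevanlinna.ConvexWrt (DiffNevanlinna.kernel d)
            {R : ℝ | r < R ∧ ENNReal.ofReal R < ρ}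
            (fun R => (DiffNevanlinna.nevanlinnaT U r R).toReal)))) ∧
    -- in the first variable: decreasing, and concave with respect to the kernel
    (∀ R : ℝ, 0 < R → ENNReal.ofReal R < ρ →
      AntitoneOn (fun r => DiffNevanlinna.nevanlinnaT U r R) (Set.Ico 0 R) ∧
      DiffNevanlinna.ConcaveWrt (DiffNevanlinna.kernel d) (Set.Ioo 0 R)
        (fun r => (DiffNevanlinna.nevanlinnaT U r R).toReal)) := by
  have : NeZero d := ⟨by omega⟩
  refine ⟨fun r R hr hrR hR => ⟨U.nevanlinnaT_nonneg r (hr.trans_lt hrR) hR, fun hr₀ =>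
    U.nevanlinnaT_ne_top hr₀ hrR.le hR⟩, fun r hr => ⟨U.monotoneOn_nevanlinnaT hr, ?_⟩,
    fun R _ hR => ⟨(U.antitone_nevanlinnaT R).antitoneOn _, U.concaveWrt_nevanlinnaT hd hR⟩⟩
  suffices h : (r = 0 ∧ ∀ R : ℝ, r < R → ENNReal.ofReal R < ρ →
      DiffNevanlinna.nevanlinnaT U r R = ⊤) ∨
      ∀ R : ℝ, r < R → ENNReal.ofReal R < ρ → DiffNevanlinna.nevanlinnaT U r R ≠ ⊤ from
    h.imp_right fun hfin => ⟨hfin, U.convexWrt_nevanlinnaT hd hr hfin⟩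
  rcases hr.eq_or_lt with rfl | hr₀
  · exact (U.nevanlinnaT_eq_top_or_ne_top le_rfl).imp_left fun htop => ⟨rfl, htop⟩
  · exact .inr fun R hrR hR => U.nevanlinnaT_ne_top hr₀ hrR.le hR
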